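/- **Notation.** $\mathbb N=\{1,2,\dots\}$, $\mathbb N_0=\mathbb N\cup\{0\}$; for $x\in\mathbb R^n$ let $\lVert x\rVert_1=\sum_i|x_i|$ and $\lVert x\rVert_\infty=\max_i|x_i|$; $\mathbb 1_{S}$ is the indicator function of $S$. For $\theta\in\mathbb R^{\mathbf d}$, $m,n\in\mathbb N$, $s\in\mathbb N_0$ with $\mathbf d\ge s+mn+m$ let $\mathcal A^{\theta,s}_{m,n}\colon\mathbb R^n\to\mathbb R^m$ be the affine function whose $i$-th component is $x\mapsto\bigl[\sum_{j=1}^n\theta_{s+(i-1)n+j}x_j\bigr]+\theta_{s+mn+i}$. For $\mathbf l=(\mathbf l_0,\dots,\mathbf l_{\mathbf L})\in\mathbb N^{\mathbf L+1}$, real $u<v$, and $\theta\in\mathbb R^{\mathbf d}$ with $\mathbf d\ge\sum_{i=1}^{\mathbf L}\mathbf l_i(\mathbf l_{i-1}+1)$, the rectified clipped network is $$\mathscr N^{\theta,\mathbf l}_{u,v}=\mathfrak a_{\mathbf L}\circ\mathcal A^{\theta,s_{\mathbf L}}_{\mathbf l_{\mathbf L},\mathbf l_{\mathbf L-1}}\circ\dots\circ\mathfrak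 a_1\circ\mathcal A^{\theta,s_1}_{\mathbf l_1,\mathbf l_0}\colon\mathbb R^{\mathbf l_0}\to\mathbb R^{\mathbf l_{\mathbf L}},\qquad s_k=\sum_{i=1}^{k-1}\mathbf l_i(\mathbf l_{i-1}+1),$$ where $\mathfrak a_i$ applies $x\mapsto\max\{x,0\}$ componentwise for $i<\mathbf L$ and $\mathfrak a_{\mathbf L}$ applies $x\mapsto\max\{u,\min\{x,v\}\}$ componentwise. **Theorem.** Let $d,\mathbf d,\mathbf L,M,K,N\in\mathbb N$, $A\in(0,\infty)$, $L,a,u\in\mathbb R$, $b\in(a,\infty)$, $v\in(u,\infty)$, $c\in[\max\{1,L,|a|,|b|,2|u|,2|v|\},\infty)$, $B\in[c,\infty)$, $\mathbf l=(\mathbf l_0,\dots,\mathbf l_{\mathbf L})\in\mathbb N^{\mathbf L+1}$, $\mathbf N\subseteq\{0,1,\dots,N\}$. Assume $0\in\mathbf N$, $\mathbf L\ge A\,\mathbb 1_{(6^d,\infty)}(A)/(2d)+1$, $\mathbf l_0=d$, $\mathbf l_1\ge A\,\mathbb 1_{(6^d,\infty)}(A)$, $\mathbf l_{\mathbf L}=1$,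 $\mathbf d\ge\sum_{i=1}^{\mathbf L}\mathbf l_i(\mathbf l_{i-1}+1)$, and $\mathbf l_i\ge\mathbb 1_{(6^d,\infty)}(A)\max\{A/d-2i+3,2\}$ for all integers $i$ with $2\le i<\mathbf L$. Let $(\Omega,\mathcal F,\mathbb P)$ be a probability space, let $X_j\colon\Omega\to[a,b]^d$ and $Y_j\colon\Omega\to[u,v]$, $j\in\mathbb N$, be functions such that $(X_j,Y_j)$, $j\in\{1,\dots,M\}$, are i.i.d. random variables, and let $\mathcal E\colon[a,b]^d\to[u,v]$ satisfy $\mathcal E(X_1)=\mathbb E[Y_1\mid X_1]$ $\mathbb P$-a.s. and $|\mathcal E(x)-\mathcal E(y)|\le L\lVert x-y\rVert_1$ for all $x,y\in[a,b]^d$. Let $\Theta_{k,n}\colon\Omega\to\mathbb R^{\mathbf d}$, $k,n\in\mathbb N_0$, and $\mathbf k\colon\Omega\to(\mathbb N_0)^2$ be random variables. Assume that $\Theta_{k,0}(\Omega)\subseteq[-B,B]^{\mathbf d}$ for all $k\in\mathbb N$, that $\Theta_{k,0}$, $k\in\{1,\dots,K\}$, are i.i.d., and that $\Theta_{1,0}$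 is uniformly distributed on $[-c,c]^{\mathbf d}$. For $\theta\in\mathbb R^{\mathbf d}$, $\omega\in\Omega$ let $\mathcal R(\theta,\omega)=\frac1M\sum_{j=1}^M|\mathscr N^{\theta,\mathbf l}_{u,v}(X_j(\omega))-Y_j(\omega)|^2$, and assume for all $\omega\in\Omega$ that $\mathbf k(\omega)$ is a minimiser of $(k,n)\mapsto\mathcal R(\Theta_{k,n}(\omega),\omega)$ over the set of all $(k,n)\in\{1,\dots,K\}\times\mathbf N$ with $\lVert\Theta_{k,n}(\omega)\rVert_\infty\le B$. Then the overall error $\omega\mapsto\int_{[a,b]^d}|\mathscr N^{\Theta_{\mathbf k(\omega)}(\omega),\mathbf l}_{u,v}(x)-\mathcal E(x)|^2\,\mathbb P_{X_1}(\mathrm dx)$ is well defined and measurable, where $\mathbb P_{X_1}$ is the law of $X_1$; its $p$-th power is integrable for all $p\in(0,\infty)$; and for all $p\in(0,\infty)$ it holds that $$\begin{aligned}&\Bigl(\mathbb E\Bigl[\Bigl(\int_{[a,b]^d}|\mathscr N^{\Theta_{\mathbf k},\mathbf l}_{u,v}(x)-\mathcal E(x)|^2\,\mathbb P_{X_1}(\mathrm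 dx)\Bigr)^p\Bigr]\Bigr)^{1/p}\\&\le\frac{9d^2L^2(b-a)^2}{A^{2/d}}+\frac{4(v-u)\mathbf L(\lVert\mathbf l\rVert_\infty+1)^{\mathbf L}c^{\mathbf L+1}\max\{1,p\}}{K^{[\mathbf L^{-1}(\lVert\mathbf l\rVert_\infty+1)^{-2}]}}\\&\quad+\frac{18\max\{1,(v-u)^2\}\mathbf L(\lVert\mathbf l\rVert_\infty+1)^2\max\{p,\ln(3MBc)\}}{\sqrt M}\\&\le\frac{36d^2c^4}{A^{2/d}}+\frac{4\mathbf L(\lVert\mathbf l\rVert_\infty+1)^{\mathbf L}c^{\mathbf L+2}\max\{1,p\}}{K^{[\mathbf L^{-1}(\lVert\mathbf l\rVert_\infty+1)^{-2}]}}+\frac{23B^3\mathbf L(\lVert\mathbf l\rVert_\infty+1)^2\max\{p,\ln(eM)\}}{\sqrt M}.\end{aligned}$$ -/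

import Mathlib

open MeasureTheory ProbabilityTheory

noncomputable section

namespace ClippedDNN

/-- The hypercube `[a, b]^d`. -/
abbrev cube (d : ℕ) (a b : ℝ) : Set (Fin d → ℝ) :=
  Set.Icc (fun _ => a) (fun _ => b)

/-- The entry of the vector `θ = (θ_1, …, θ_D)` with zero-based index `k`, i.e. `θ_{k+1}`
(the value `0` for `k ≥ D` is never used when `D` is at least the number of parameters). -/
def param {D : ℕ} (θ : Fin D → ℝ) (k : ℕ) : ℝ :=
  if h : k < D then θ ⟨k, h⟩ else 0

/-- The affine map `ℝ^n → ℝ^m` whose weight matrix is stored row by row in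
`θ_{s+1}, …, θ_{s+mn}` and whose bias is `(θ_{s+mn+1}, …, θ_{s+mn+m})`. -/
def affine {D : ℕ} (m n : ℕ) (θ : Fin D → ℝ) (s : ℕ) (x : Fin n → ℝ) : Fin m → ℝ :=
  fun i => (∑ j : Fin n, param θ (s + (i : ℕ) * n + j) * x j) + param θ (s + m * n + i)

/-- `∑_{i=1}^{k} l_i (l_{i-1} + 1)`, the number of parameters of the first `k` layers. -/
def numParams (l : ℕ → ℕ) (k : ℕ) : ℕ :=
  ∑ i ∈ Finset.Icc 1 k, l i * (l (i - 1) + 1)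

/-- The fully connected feedforward network with layer widths `l 0, …, l k`, activation functions
`act 1, …, act k`, and parameters read from `θ` starting after position `s`:
`act k ∘ A_k ∘ act (k-1) ∘ A_{k-1} ∘ … ∘ act 1 ∘ A_1`. -/
def network {D : ℕ} (l : ℕ → ℕ) (act : (i : ℕ) → (Fin (l i) → ℝ) → Fin (l i) → ℝ)
    (θ : Fin D → ℝ) (s : ℕ) : (k : ℕ) → (Fin (l 0) → ℝ) → Fin (l k) → ℝ
  | 0, x => x
  | k + 1, x =>
      act (k + 1) (affine (l (k + 1)) (l k) θ (s + numParams l k) (network l act θ s k x))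

/-- The rectifier function. -/
def rect (x : ℝ) : ℝ := max x 0

/-- The clipping function. -/
def clip (u v x : ℝ) : ℝ := max u (min x v)

/-- The rectified clipped network of depth `depth` with layer widths `l 0, …, l depth`: the
rectifier acts componentwise on the hidden layers, the clipping function on the output layer.
Only the values `l 0, …, l depth` of `l` matter. -/
def clippedNN {D : ℕ} (depth : ℕ) (l : ℕ → ℕ) (u v : ℝ) (θ : Fin D → ℝ) :
    (Fin (l 0) → ℝ) → Fin (l depth) → ℝ :=
  network l (fun i x j => if i = depth then clip u v (x j) else rect (x j)) θ 0 depth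

/-- The rectified clipped network regarded as a function `ℝ^d → ℝ` when `l 0 = d` and
`l depth = 1`. -/
def realNN {D d depth : ℕ} {l : ℕ → ℕ} (h0 : l 0 = d) (h1 : l depth = 1) (u v : ℝ)
    (θ : Fin D → ℝ) (x : Fin d → ℝ) : ℝ :=
  clippedNN depth l u v θ (fun i => x (Fin.cast h0 i)) (Fin.cast h1.symm 0)

/-- `‖(l_0, …, l_depth)‖_∞`. -/
def maxWidth (depth : ℕ) (l : ℕ → ℕ) : ℕ :=
  (Finset.range (depth + 1)).sup l

/-- The squared `L²`-distance `∫_{[a,b]^d} |N_θ(x) - E(x)|² μ(dx)` of a network with parameter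
vector `θ` from a function `E`. -/
def sqError {D d depth : ℕ} {l : ℕ → ℕ} (h0 : l 0 = d) (h1 : l depth = 1) {a b u v : ℝ}
    (E : cube d a b → Set.Icc u v) (μ : Measure (cube d a b)) (θ : Fin D → ℝ) : ℝ :=
  ∫ x, |realNN h0 h1 u v θ x - (E x : ℝ)| ^ 2 ∂μ

end ClippedDNN

end

open ClippedDNN

/-! The error of the selected network splits into approximation, generalisation and optimisation
parts. Since `E` is the regression function, the risk of a network equals its squared distance from
`E` plus a variance independent of the parameters (`risk_eq_sqError_add`). So squared distances may
be compared through risks, and risks through empirical risks at the cost of a uniform deviation `G`.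
Let `ϑ` in `[-c, c]^D` be a good approximant. The selected parameter has empirical risk at most that
of each initial sample `Θ k 0`, in particular of the one nearest to `ϑ`, whose empirical risk is
close to that of `ϑ` by Lipschitz continuity in the parameters. This gives the three-term bound
`sqError_le_of_empRisk_le`.

Approximation (`exists_params_approx`): a Lipschitz function is nearly the maximum of the downward
cones `E(p) - L‖x - p‖₁` over grid points `p`. A rectifier network computes the `ℓ¹` distances in
its first layer, the cones in its second, and then folds one further cone per layer into a running
maximum. For `A ≤ 6^d` a constant network is good enough.

Generalisation (`exists_uniform_deviation`): Hoeffding tails bound the `q`-th moment of the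
deviation at one parameter. The `ℓ^q` norm over a finite net costs only a factor `e` when `q` is at
least the logarithm of the size of the net, and Lipschitz continuity extends the bound from the net
to all parameters.

Optimisation (`eLpNorm_min_headDist_le`): a uniform sample is within `t` of `ϑ` in `n` coordinates
with probability at least `(t / 2c)^n` for `t ≤ 2c`, so the minimum over `K` independent samples has
moments of order `K^(-1/n)`. Only the coordinates that the network reads are measured, so `n` is the
number of network parameters and not `D`. -/

namespace ClippedDNN

/-! ### Growth and Lipschitz estimates for the layers in terms of the parameters. -/

section Network

variable {D : ℕ}

lemma numParams_succ (l : ℕ → ℕ) (k : ℕ) :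
    numParams l (k + 1) = numParams l k + l (k + 1) * (l k + 1) := by
  simp [numParams, Finset.sum_Icc_succ_top]

lemma numParams_mono (l : ℕ → ℕ) : Monotone (numParams l) :=
  monotone_nat_of_le_succ fun k => by rw [numParams_succ]; exact Nat.le_add_right _ _

lemma weight_index_lt (l : ℕ → ℕ) {k depth : ℕ} (hk : k < depth) (i : Fin (l (k + 1)))
    (j : Fin (l k)) : 0 + numParams l k + (i : ℕ) * l k + j < numParams l depth := by
  refine lt_of_lt_of_le ?_ (numParams_mono l hk)
  rw [numParams_succ]
  have h : ((i : ℕ) + 1) * l k ≤ l (k + 1) * l k := Nat.mul_le_mul_right _ i.2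
  have := j.2
  nlinarith

lemma bias_index_lt (l : ℕ → ℕ) {k depth : ℕ} (hk : k < depth) (i : Fin (l (k + 1))) :
    0 + numParams l k + l (k + 1) * l k + i < numParams l depth := by
  refine lt_of_lt_of_le ?_ (numParams_mono l hk)
  rw [numParams_succ]
  have := i.2
  nlinarith

lemma le_maxWidth {depth k : ℕ} (l : ℕ → ℕ) (hk : k ≤ depth) : l k ≤ maxWidth depth l :=
  Finset.le_sup (f := l) (Finset.mem_range.2 (Nat.lt_succ_of_le hk))

lemma numParams_le (l : ℕ → ℕ) (depth : ℕ) :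
    numParams l depth ≤ depth * (maxWidth depth l * (maxWidth depth l + 1)) := by
  unfold numParams
  calc _ ≤ ∑ _i ∈ Finset.Icc 1 depth, maxWidth depth l * (maxWidth depth l + 1) := by
        refine Finset.sum_le_sum fun i hi => ?_
        have hi' := Finset.mem_Icc.1 hi
        exact Nat.mul_le_mul (le_maxWidth l hi'.2)
          (Nat.succ_le_succ (le_maxWidth l (by omega)))
    _ = _ := by simp

lemma rect_nonneg (x : ℝ) : 0 ≤ rect x := le_max_right _ _

lemma rect_of_nonneg {x : ℝ} (hx : 0 ≤ x) : rect x = x := max_eq_left hx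

lemma abs_rect_le (x : ℝ) : |rect x| ≤ |x| := by
  rw [abs_of_nonneg (rect_nonneg x)]
  exact max_le (le_abs_self x) (abs_nonneg x)

lemma abs_rect_sub_rect_le (x y : ℝ) : |rect x - rect y| ≤ |x - y| := by
  simpa [rect] using abs_max_sub_max_le_abs x y 0

lemma abs_clip_sub_clip_le (u v x y : ℝ) : |clip u v x - clip u v y| ≤ |x - y| := by
  unfold clip
  rw [max_comm u, max_comm u]
  refine (abs_max_sub_max_le_abs _ _ u).trans ?_
  have h := abs_min_sub_min_le_max x v y v
  simpa using h

lemma clip_mem {u v : ℝ} (huv : u ≤ v) (x : ℝ) : clip u v x ∈ Set.Icc u v :=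
  ⟨le_max_left _ _, max_le huv (min_le_right _ _)⟩

lemma clip_of_mem {u v x : ℝ} (hx : x ∈ Set.Icc u v) : clip u v x = x := by
  rw [clip, min_eq_left hx.2, max_eq_right hx.1]

/-- The activation functions of the rectified clipped network. -/
abbrev clipAct (depth : ℕ) (l : ℕ → ℕ) (u v : ℝ) (i : ℕ) (x : Fin (l i) → ℝ) (j : Fin (l i)) : ℝ :=
  if i = depth then clip u v (x j) else rect (x j)

lemma clipAct_lipschitz (depth : ℕ) (l : ℕ → ℕ) (u v : ℝ) (i : ℕ) (x y : Fin (l i) → ℝ)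
    (j : Fin (l i)) : |clipAct depth l u v i x j - clipAct depth l u v i y j| ≤ |x j - y j| := by
  unfold clipAct
  split_ifs
  · exact abs_clip_sub_clip_le ..
  · exact abs_rect_sub_rect_le ..

/-- If `m ≥ 1` bounds one layer, a neuron of the next is at most `wβm + β ≤ (w + 1)βm`. Output
neurons are excluded because clipping, unlike the rectifier, may increase absolute values. -/
lemma network_abs_le {depth : ℕ} {l : ℕ → ℕ} {u v β c : ℝ} {θ : Fin D → ℝ} {x : Fin (l 0) → ℝ}
    (hβ : 1 ≤ β) (hc : 1 ≤ c) (hθ : ∀ i < numParams l depth, |param θ i| ≤ β)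
    (hx : ∀ i, |x i| ≤ c) {k : ℕ} (hk : k < depth) (i : Fin (l k)) :
    |network l (clipAct depth l u v) θ 0 k x i| ≤ c * ((maxWidth depth l : ℝ) + 1) ^ k * β ^ k := by
  induction k with
  | zero => simpa [network] using hx i
  | succ k ih =>
    have hk' : k < depth := by omega
    set w : ℝ := (maxWidth depth l : ℝ)
    have hw : (l k : ℝ) ≤ w := Nat.cast_le.2 (le_maxWidth l hk'.le)
    have hw0 : 0 ≤ w := by positivity
    set m := c * (w + 1) ^ k * β ^ k
    have hm : 1 ≤ m :=
      one_le_mul_of_one_le_of_one_le (one_le_mul_of_one_le_of_one_le hc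
        (one_le_pow₀ (by linarith))) (one_le_pow₀ hβ)
    simp only [network, clipAct, if_neg hk.ne]
    refine (abs_rect_le _).trans ?_
    unfold affine
    refine (abs_add_le _ _).trans ?_
    have hb := hθ _ (bias_index_lt l hk' i)
    have hs : |∑ j : Fin (l k), param θ (0 + numParams l k + (i : ℕ) * l k + j) *
        network l (clipAct depth l u v) θ 0 k x j| ≤ (l k : ℝ) * (β * m) := by
      refine (Finset.abs_sum_le_sum_abs _ _).trans ?_
      refine (Finset.sum_le_card_nsmul _ _ (β * m) fun j _ => ?_).trans (by simp)
      rw [abs_mul]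
      exact mul_le_mul (hθ _ (weight_index_lt l hk' i j)) (ih hk' j) (abs_nonneg _) (by linarith)
    have h1 : (l k : ℝ) * (β * m) ≤ w * (β * m) := mul_le_mul_of_nonneg_right hw (by positivity)
    have h2 : β * 1 ≤ β * m := mul_le_mul_of_nonneg_left hm (by linarith)
    calc _ ≤ w * (β * m) + β * m := by linarith
      _ = _ := by simp only [m]; ring

/-- All activations are 1-Lipschitz, so a layer amplifies the inherited error by at most `wβ` and
adds at most `(w + 1)δm`, where `m` bounds the previous layer. The recursion adds one such term per
layer, whence the factor `k`. -/
lemma network_sub_abs_le {depth : ℕ} {l : ℕ → ℕ} {u v β c δ : ℝ} {θ ϑ : Fin D → ℝ}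
    {x : Fin (l 0) → ℝ} (hβ : 1 ≤ β) (hc : 1 ≤ c)
    (hθ : ∀ i < numParams l depth, |param θ i| ≤ β)
    (hϑ : ∀ i < numParams l depth, |param ϑ i| ≤ β)
    (hδ : ∀ i < numParams l depth, |param θ i - param ϑ i| ≤ δ) (hδ0 : 0 ≤ δ)
    (hx : ∀ i, |x i| ≤ c) {k : ℕ} (hk : k ≤ depth) (i : Fin (l k)) :
    |network l (clipAct depth l u v) θ 0 k x i - network l (clipAct depth l u v) ϑ 0 k x i|
      ≤ k * c * ((maxWidth depth l : ℝ) + 1) ^ k * β ^ (k - 1) * δ := by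
  induction k with
  | zero => simp [network]
  | succ k ih =>
    have hk' : k < depth := by omega
    set w : ℝ := (maxWidth depth l : ℝ)
    have hw : (l k : ℝ) ≤ w := Nat.cast_le.2 (le_maxWidth l hk'.le)
    have hw0 : 0 ≤ w := by positivity
    have hβ0 : 0 ≤ β := by linarith
    set m := c * (w + 1) ^ k * β ^ k
    have hm : 1 ≤ m :=
      one_le_mul_of_one_le_of_one_le (one_le_mul_of_one_le_of_one_le hc
        (one_le_pow₀ (by linarith))) (one_le_pow₀ hβ)
    set e := k * c * (w + 1) ^ k * β ^ (k - 1) * δ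
    have he : 0 ≤ e := by positivity
    simp only [network]
    refine (clipAct_lipschitz ..).trans ?_
    unfold affine
    rw [add_sub_add_comm, ← Finset.sum_sub_distrib]
    refine (abs_add_le _ _).trans ?_
    have hb := hδ _ (bias_index_lt l hk' i)
    have hs : |∑ j : Fin (l k), (param θ (0 + numParams l k + (i : ℕ) * l k + j) *
        network l (clipAct depth l u v) θ 0 k x j -
        param ϑ (0 + numParams l k + (i : ℕ) * l k + j) *
        network l (clipAct depth l u v) ϑ 0 k x j)| ≤ (l k : ℝ) * (β * e + δ * m) := by
      refine (Finset.abs_sum_le_sum_abs _ _).trans ?_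
      refine (Finset.sum_le_card_nsmul _ _ (β * e + δ * m) fun j _ => ?_).trans (by simp [mul_add])
      set p := param θ (0 + numParams l k + (i : ℕ) * l k + j)
      set q := param ϑ (0 + numParams l k + (i : ℕ) * l k + j)
      have hi := weight_index_lt l hk' i j
      have e1 : ∀ s t : ℝ, p * s - q * t = q * (s - t) + (p - q) * s := fun s t => by ring
      rw [e1]
      refine (abs_add_le _ _).trans (add_le_add ?_ ?_)
      · rw [abs_mul]
        exact mul_le_mul (hϑ _ hi) (ih hk'.le j) (abs_nonneg _) hβ0
      · rw [abs_mul]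
        exact mul_le_mul (hδ _ hi) (network_abs_le hβ hc hθ hx hk' j) (abs_nonneg _) hδ0
    have h1 : (l k : ℝ) * (β * e + δ * m) ≤ w * (β * e + δ * m) :=
      mul_le_mul_of_nonneg_right hw (by positivity)
    have h2 : δ * 1 ≤ δ * m := mul_le_mul_of_nonneg_left hm hδ0
    -- For `k = 0` the truncated exponent `k - 1` is wrong by one, but the factor `k` annihilates
    -- both sides.
    have h3 : β * e = k * m * δ := by
      rcases k with _ | k
      · simp [e]
      · simp only [e, m, Nat.add_sub_cancel]; ring
    have h4 : 0 ≤ (k : ℝ) * m * δ := by positivity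
    calc _ ≤ w * (β * e + δ * m) + δ * m := by linarith
      _ ≤ (w + 1) * (k * m * δ) + (w + 1) * (δ * m) := by rw [h3]; nlinarith
      _ = _ := by simp only [m, Nat.add_sub_cancel]; push_cast; ring

end Network

/-! ### The scalar-valued network: range, Lipschitz bound, joint continuity. -/

section RealNN

variable {D d depth : ℕ} {l : ℕ → ℕ} {u v : ℝ}

lemma realNN_mem (h0 : l 0 = d) (h1 : l depth = 1) (hdepth : 1 ≤ depth) (huv : u ≤ v)
    (θ : Fin D → ℝ) (x : Fin d → ℝ) : realNN h0 h1 u v θ x ∈ Set.Icc u v := by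
  obtain ⟨k, rfl⟩ : ∃ k, depth = k + 1 := ⟨depth - 1, by omega⟩
  simp only [realNN, clippedNN, network, if_true]
  exact clip_mem huv _

/-- Lipschitz continuity of the clipped network in those parameters that it reads. -/
lemma realNN_sub_abs_le (h0 : l 0 = d) (h1 : l depth = 1) {β c δ : ℝ} {θ ϑ : Fin D → ℝ}
    {x : Fin d → ℝ} (hβ : 1 ≤ β) (hc : 1 ≤ c)
    (hθ : ∀ i < numParams l depth, |param θ i| ≤ β)
    (hϑ : ∀ i < numParams l depth, |param ϑ i| ≤ β)
    (hδ : ∀ i < numParams l depth, |param θ i - param ϑ i| ≤ δ) (hδ0 : 0 ≤ δ)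
    (hx : ∀ i, |x i| ≤ c) :
    |realNN h0 h1 u v θ x - realNN h0 h1 u v ϑ x|
      ≤ depth * c * ((maxWidth depth l : ℝ) + 1) ^ depth * β ^ (depth - 1) * δ :=
  network_sub_abs_le hβ hc hθ hϑ hδ hδ0 (fun _ => hx _) le_rfl _

lemma continuous_param (k : ℕ) : Continuous fun θ : Fin D → ℝ => param θ k := by
  unfold param
  split_ifs <;> fun_prop

lemma continuous_network (l : ℕ → ℕ) (depth : ℕ) (u v : ℝ) (k : ℕ) :
    Continuous fun q : (Fin D → ℝ) × (Fin (l 0) → ℝ) =>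
      network l (clipAct depth l u v) q.1 0 k q.2 := by
  induction k with
  | zero => simpa [network] using continuous_snd
  | succ k ih =>
    simp only [network]
    refine continuous_pi fun i => ?_
    have h : Continuous fun q : (Fin D → ℝ) × (Fin (l 0) → ℝ) =>
        affine (l (k + 1)) (l k) q.1 (0 + numParams l k)
          (network l (clipAct depth l u v) q.1 0 k q.2) i := by
      unfold affine
      refine Continuous.add (continuous_finsetSum _ fun j _ => ?_)
        ((continuous_param _).comp continuous_fst)
      exact ((continuous_param _).comp continuous_fst).mul ((continuous_apply j).comp ih)
    unfold clipAct clip rect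
    split_ifs
    · exact continuous_const.max (h.min continuous_const)
    · exact h.max continuous_const

lemma continuous_realNN (h0 : l 0 = d) (h1 : l depth = 1) :
    Continuous fun q : (Fin D → ℝ) × (Fin d → ℝ) => realNN h0 h1 u v q.1 q.2 := by
  have h := continuous_network (D := D) l depth u v depth
  have h2 : Continuous fun q : (Fin D → ℝ) × (Fin d → ℝ) =>
      (q.1, fun i : Fin (l 0) => q.2 (Fin.cast h0 i)) := by fun_prop
  exact (continuous_apply (Fin.cast h1.symm 0)).comp (h.comp h2)

end RealNN

/-! ### Storing prescribed weights and biases in a parameter vector. -/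

section Realisation

/-- The layers occupy consecutive blocks of positions, so a new layer can be written from position
`numParams l n` on without disturbing earlier ones; within the weight block, quotient and remainder
by `l n` recover row and column. -/
lemma exists_layer_encoding (l : ℕ → ℕ) {W : ℕ → ℕ → ℕ → ℝ} {β : ℕ → ℕ → ℝ} {c : ℝ}
    (hc : 0 ≤ c) (hW : ∀ k i j, |W k i j| ≤ c) (hβ : ∀ k i, |β k i| ≤ c) (n : ℕ) :
    ∃ g : ℕ → ℝ, (∀ t, |g t| ≤ c) ∧ ∀ k < n, ∀ i < l (k + 1),
      (∀ j < l k, g (numParams l k + i * l k + j) = W k i j) ∧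
        g (numParams l k + l (k + 1) * l k + i) = β k i := by
  induction n with
  | zero => exact ⟨fun _ => 0, by simpa using hc, by simp⟩
  | succ n ih =>
    obtain ⟨g, hg, hgl⟩ := ih
    refine ⟨fun t => if t < numParams l n then g t else
      if t - numParams l n < l (n + 1) * l n then
        W n ((t - numParams l n) / l n) ((t - numParams l n) % l n)
      else β n (t - numParams l n - l (n + 1) * l n), fun t => ?_, fun k hk i hi => ?_⟩
    · dsimp only
      split_ifs
      exacts [hg t, hW _ _ _, hβ _ _]
    · rcases Nat.lt_succ_iff_lt_or_eq.1 hk with hk | rfl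
      · obtain ⟨h1, h2⟩ := hgl k hk i hi
        refine ⟨fun j hj => ?_, ?_⟩
        · have := weight_index_lt l hk ⟨i, hi⟩ ⟨j, hj⟩
          simp only [zero_add] at this
          rw [← h1 j hj]
          exact if_pos this
        · have := bias_index_lt l hk ⟨i, hi⟩
          simp only [zero_add] at this
          rw [← h2]
          exact if_pos this
      · refine ⟨fun j hj => ?_, ?_⟩
        · have h : i * l k + j < l (k + 1) * l k := by
            have : (i + 1) * l k ≤ l (k + 1) * l k := Nat.mul_le_mul_right _ hi
            nlinarith
          have e : numParams l k + i * l k + j - numParams l k = i * l k + j := by omega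
          dsimp only
          rw [if_neg (by omega), e, if_pos h, mul_comm i, Nat.mul_add_div (by omega),
            Nat.div_eq_of_lt hj, Nat.mul_add_mod, Nat.mod_eq_of_lt hj, add_zero]
        · dsimp only
          rw [if_neg (by omega), if_neg (by omega)]
          congr 1
          omega

/-- Any network given by bounded weight matrices and biases is realised by a parameter vector.
If `h` follows the hidden layers of the network on the input `x`, then the output of the network
is determined by the last hidden layer of `h`. -/
lemma exists_params_of_layers {D d k : ℕ} {l : ℕ → ℕ} (h0 : l 0 = d) (h1 : l (k + 1) = 1)
    (u v : ℝ) (hparams : numParams l (k + 1) ≤ D) {W : ℕ → ℕ → ℕ → ℝ} {β : ℕ → ℕ → ℝ} {c : ℝ}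
    (hc : 0 ≤ c) (hW : ∀ k i j, |W k i j| ≤ c) (hβ : ∀ k i, |β k i| ≤ c) :
    ∃ θ : Fin D → ℝ, (∀ i, |θ i| ≤ c) ∧ ∀ (x : Fin d → ℝ) (h : ℕ → ℕ → ℝ),
      (∀ i < d, h 0 i = param x i) →
      (∀ n < k, ∀ i < l (n + 1),
        h (n + 1) i = rect (∑ j ∈ Finset.range (l n), W n i j * h n j + β n i)) →
      realNN h0 h1 u v θ x = clip u v (∑ j ∈ Finset.range (l k), W k 0 j * h k j + β k 0) := by
  obtain ⟨g, hg, hgl⟩ := exists_layer_encoding l hc hW hβ (k + 1)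
  refine ⟨fun t => g t, fun i => hg _, fun x h hx hh => ?_⟩
  have hpar : ∀ t < numParams l (k + 1), param (fun t : Fin D => g t) t = g t := fun t ht => by
    simp [param, ht.trans_le hparams]
  have haff : ∀ n < k + 1, ∀ (y : Fin (l n) → ℝ) (i : Fin (l (n + 1))),
      (∀ j, y j = h n j) → affine (l (n + 1)) (l n) (fun t : Fin D => g t) (0 + numParams l n) y i
        = ∑ j ∈ Finset.range (l n), W n i j * h n j + β n i := by
    intro n hn y i hy
    obtain ⟨hw, hb⟩ := hgl n hn i i.2
    unfold affine
    rw [hpar _ (bias_index_lt l hn i), Finset.sum_range]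
    simp only [zero_add]
    rw [hb]
    congr 1
    refine Finset.sum_congr rfl fun j _ => ?_
    have := weight_index_lt l hn i j
    rw [zero_add] at this
    rw [hpar _ this, hw j j.2, hy]
  have hstate : ∀ n ≤ k, ∀ i : Fin (l n), network l (clipAct (k + 1) l u v)
      (fun t : Fin D => g t) 0 n (fun i => x (Fin.cast h0 i)) i = h n i := by
    intro n
    induction n with
    | zero =>
      intro _ i
      have : (i : ℕ) < d := h0 ▸ i.2
      rw [hx _ this]
      simp only [network, param, this, dif_pos]
      rfl
    | succ n ih =>
      intro hn i
      simp only [network, clipAct]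
      rw [if_neg (by omega), haff n (by omega) _ i (ih (by omega)), hh n (by omega) i i.2]
  simp only [realNN, clippedNN, network, if_true]
  rw [haff k (by omega) _ _ (hstate k le_rfl)]
  simp

end Realisation

/-! ### A rectifier network for the maximum of finitely many cones. -/

section Cones

/-- `max (z 0) (z 1)`, followed by the maxima with `(z 2)⁺, …, (z (k + 1))⁺`, where only the
first `N` values of `z` are taken into account. -/
def runMax (N : ℕ) (z : ℕ → ℝ) : ℕ → ℝ
  | 0 => max (z 0) (z 1)
  | k + 1 => max (runMax N z k) (if k + 2 < N then rect (z (k + 2)) else 0)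

/-- The vanishing of `h` beyond `n` replaces the condition `t < n`, so a weight row may select a
neuron that the layer does not have. -/
lemma sum_range_single {n : ℕ} {h : ℕ → ℝ} (hh : ∀ j, n ≤ j → h j = 0) (t : ℕ) :
    ∑ j ∈ Finset.range n, (if j = t then (1 : ℝ) else 0) * h j = h t := by
  simp only [ite_mul, one_mul, zero_mul, Finset.sum_ite_eq', Finset.mem_range]
  split_ifs with ht
  · rfl
  · exact (hh t (by omega)).symm

lemma sum_range_mul_eq (N d : ℕ) (F : ℕ → ℝ) :
    ∑ j ∈ Finset.range (N * d), F j
      = ∑ q ∈ Finset.range N, ∑ i ∈ Finset.range d, F (q * d + i) := by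
  induction N with
  | zero => simp
  | succ N ih => rw [Nat.succ_mul, Finset.sum_range_add, ih, Finset.sum_range_succ]

lemma rect_add_rect_neg (x : ℝ) : rect x + rect (-x) = |x| := by
  unfold rect
  rcases le_total 0 x with h | h
  · rw [max_eq_left h, max_eq_right (by linarith), abs_of_nonneg h, add_zero]
  · rw [max_eq_right h, max_eq_left (by linarith), abs_of_nonpos h, zero_add]

lemma rect_sub_rect_neg (x : ℝ) : rect x - rect (-x) = x := by
  unfold rect
  rcases le_total 0 x with h | h
  · rw [max_eq_left h, max_eq_right (by linarith), sub_zero]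
  · rw [max_eq_right h, max_eq_left (by linarith)]; ring

lemma rect_sub_add (x y : ℝ) : rect (x - y) + y = max x y := by
  unfold rect
  rw [← max_add_add_right]; simp

/-- Weights of the row computing the cone with index `q` from the first hidden layer. -/
def coneWeight (N d : ℕ) (L : ℝ) (q j : ℕ) : ℝ :=
  if j < N * d then (if j / d = q then -L else 0)
  else if j < 2 * (N * d) then (if (j - N * d) / d = q then -L else 0) else 0

lemma abs_coneWeight_le (N d : ℕ) {L : ℝ} (hL : 0 ≤ L) (q j : ℕ) : |coneWeight N d L q j| ≤ L := by
  unfold coneWeight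
  split_ifs <;> simp [abs_of_nonneg hL, hL]

/-- Rows of distinct cones have disjoint supports, so subtracting them does not double the bound. -/
lemma abs_coneWeight_sub_le (N d : ℕ) {L : ℝ} (hL : 0 ≤ L) (q q' j : ℕ) :
    |coneWeight N d L q j - coneWeight N d L q' j| ≤ L := by
  unfold coneWeight
  split_ifs <;> simp [abs_of_nonneg hL, hL]

/-- Outputs of the first hidden layer of the cone network. -/
def coneLayer (N d : ℕ) (p : ℕ → ℕ → ℝ) (y : ℕ → ℝ) (t : ℕ) : ℝ :=
  if t < N * d then rect (y (t % d) - p (t / d) (t % d))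
  else if t < 2 * (N * d) then
    rect (-(y ((t - N * d) % d) - p ((t - N * d) / d) ((t - N * d) % d))) else 0

/-- The first `N * d` neurons hold positive parts, the next `N * d` negative parts, and each half
contains one block of length `d` per cone. The two blocks of cone `q` combine through `x⁺ + (-x)⁺ =
|x|`; surplus neurons have weight zero. -/
lemma sum_coneWeight_mul_coneLayer {N d n q : ℕ} (hd : 1 ≤ d) (hn : 2 * (N * d) ≤ n) (hq : q < N)
    (L : ℝ) (p : ℕ → ℕ → ℝ) (y : ℕ → ℝ) :
    ∑ j ∈ Finset.range n, coneWeight N d L q j * coneLayer N d p y j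
      = -L * ∑ i ∈ Finset.range d, |y i - p q i| := by
  obtain ⟨r, rfl⟩ := Nat.exists_eq_add_of_le hn
  have key : ∀ G : ℝ → ℝ, ∑ j ∈ Finset.range (N * d),
      (if j / d = q then -L else 0) * G (y (j % d) - p (j / d) (j % d))
      = -L * ∑ i ∈ Finset.range d, G (y i - p q i) := by
    intro G
    rw [sum_range_mul_eq, Finset.sum_eq_single_of_mem q (Finset.mem_range.2 hq)]
    · rw [Finset.mul_sum]
      refine Finset.sum_congr rfl fun i hi => ?_
      have hi := Finset.mem_range.1 hi
      rw [mul_comm q d, Nat.mul_add_div (by omega), Nat.div_eq_of_lt hi, Nat.mul_add_mod,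
        Nat.mod_eq_of_lt hi, add_zero, if_pos rfl]
    · intro q' _ hq'
      refine Finset.sum_eq_zero fun i hi => ?_
      have hi := Finset.mem_range.1 hi
      rw [mul_comm q' d, Nat.mul_add_div (by omega), Nat.div_eq_of_lt hi, add_zero, if_neg hq',
        zero_mul]
  rw [Finset.sum_range_add, two_mul, Finset.sum_range_add]
  have e1 : ∑ j ∈ Finset.range (N * d), coneWeight N d L q j * coneLayer N d p y j
      = -L * ∑ i ∈ Finset.range d, rect (y i - p q i) := by
    rw [← key]
    refine Finset.sum_congr rfl fun j hj => ?_
    have hj := Finset.mem_range.1 hj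
    simp only [coneWeight, coneLayer, if_pos hj]
  have e2 : ∑ j ∈ Finset.range (N * d),
      coneWeight N d L q (N * d + j) * coneLayer N d p y (N * d + j)
      = -L * ∑ i ∈ Finset.range d, rect (-(y i - p q i)) := by
    rw [← key fun x => rect (-x)]
    refine Finset.sum_congr rfl fun j hj => ?_
    have hj := Finset.mem_range.1 hj
    have hj1 : ¬ N * d + j < N * d := by omega
    have hj2 : N * d + j < 2 * (N * d) := by omega
    simp only [coneWeight, coneLayer, if_neg hj1, if_pos hj2, Nat.add_sub_cancel_left]
  have e3 : ∑ j ∈ Finset.range r,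
      coneWeight N d L q (N * d + N * d + j) * coneLayer N d p y (N * d + N * d + j) = 0 := by
    refine Finset.sum_eq_zero fun j _ => ?_
    simp only [coneWeight]
    rw [if_neg (by omega), if_neg (by omega), zero_mul]
  rw [e1, e2, e3, add_zero, ← mul_add, ← Finset.sum_add_distrib]
  simp only [rect_add_rect_neg]

/-- A network that computes the maximum of `N` cones, clipped to `[u, v]`. -/
lemma exists_params_max_cones {D d depth N : ℕ} {l : ℕ → ℕ} (h0 : l 0 = d) (h1 : l depth = 1)
    (hd : 1 ≤ d) (hparams : numParams l depth ≤ D) (hN : 3 ≤ N) (hdepth : N + 1 ≤ depth)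
    (hl1 : 2 * (N * d) ≤ l 1) (hl2 : N + 1 ≤ l 2)
    (hli : ∀ k, 3 ≤ k → k < depth → 2 ≤ l k ∧ N + 2 ≤ l k + k)
    {u v c L : ℝ} (hL : 0 ≤ L) (hLc : L ≤ c) (hc : 1 ≤ c) (hu : |u| ≤ c)
    {p : ℕ → ℕ → ℝ} {f : ℕ → ℝ} (hp : ∀ q i, |p q i| ≤ c) (hfu : ∀ q, |f q - u| ≤ c)
    (hff : ∀ q q', |f q - f q'| ≤ c) :
    ∃ θ : Fin D → ℝ, (∀ i, |θ i| ≤ c) ∧ ∀ x : Fin d → ℝ,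
      realNN h0 h1 u v θ x = clip u v (runMax N
        (fun q => f q - u - L * ∑ i ∈ Finset.range d, |param x i - p q i|) (depth - 3) + u) := by
  obtain ⟨r, rfl⟩ : ∃ r, depth = r + 3 + 1 := ⟨depth - 4, by omega⟩
  have hc0 : 0 ≤ c := by linarith
  set e : ℕ → ℕ → ℝ := fun t j => if j = t then 1 else 0 with he
  -- The identity `(x - y)⁺ + y = max x y` drives the construction. After the second layer `z 1`
  -- must be available with its sign, hence the two neurons `(z 1)⁺` and `(-z 1)⁺`; all later cones
  -- are kept as positive parts, which pass through rectifiers unchanged. Each later hidden layer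
  -- stores `(running max - next cone)⁺`, that next cone, and the cones still waiting, so the
  -- required width drops by one per layer. The output row, `k = r`, subtracts no further cone and
  -- adds back `u`.
  set W : ℕ → ℕ → ℕ → ℝ := fun k i j => match k with
    | 0 => if i < N * d then e (i % d) j else
        if i < 2 * (N * d) then -e ((i - N * d) % d) j else 0
    | 1 => match i with
      | 0 => coneWeight N d L 0 j - coneWeight N d L 1 j
      | 1 => coneWeight N d L 1 j
      | 2 => -coneWeight N d L 1 j
      | i + 3 => if i + 2 < N then coneWeight N d L (i + 2) j else 0
    | 2 => match i with
      | 0 => e 0 j + e 1 j - e 2 j - e 3 j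
      | i + 1 => e (i + 3) j
    | k + 3 => match i with
      | 0 => e 0 j + e 1 j - (if k = r then 0 else e 2 j)
      | i + 1 => e (i + 2) j with hWdef
  set β : ℕ → ℕ → ℝ := fun k i => match k with
    | 0 => if i < N * d then -p (i / d) (i % d) else
        if i < 2 * (N * d) then p ((i - N * d) / d) ((i - N * d) % d) else 0
    | 1 => match i with
      | 0 => f 0 - f 1
      | 1 => f 1 - u
      | 2 => -(f 1 - u)
      | i + 3 => if i + 2 < N then f (i + 2) - u else 0
    | 2 => 0
    | k + 3 => if k = r then u else 0 with hβdef
  have hW : ∀ k i j, |W k i j| ≤ c := by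
    have hcw := fun q j => (abs_coneWeight_le N d hL q j).trans hLc
    have hcs := fun q q' j => (abs_coneWeight_sub_le N d hL q q' j).trans hLc
    intro k i j
    rcases k with _ | _ | _ | k
    · simp only [hWdef, he]
      split_ifs <;> simp <;> linarith
    · rcases i with _ | _ | _ | i
      · exact hcs ..
      · exact hcw ..
      · simpa only [hWdef, abs_neg] using hcw 1 j
      · simp only [hWdef]
        split_ifs
        · exact hcw ..
        · simpa using hc0
    · rcases i with _ | i
      · simp only [hWdef, he]
        split_ifs <;> first | omega | (norm_num; linarith)
      · simp only [hWdef, he]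
        split_ifs <;> norm_num <;> linarith
    · rcases i with _ | i
      · simp only [hWdef, he]
        split_ifs <;> first | omega | (norm_num; linarith)
      · simp only [hWdef, he]
        split_ifs <;> norm_num <;> linarith
  have hβ : ∀ k i, |β k i| ≤ c := by
    intro k i
    rcases k with _ | _ | _ | k
    · simp only [hβdef]
      split_ifs
      · simpa using hp ..
      · exact hp ..
      · simpa using hc0
    · rcases i with _ | _ | _ | i
      · exact hff ..
      · exact hfu ..
      · simpa only [hβdef, abs_neg] using hfu 1
      · simp only [hβdef]
        split_ifs
        · exact hfu ..
        · simpa using hc0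
    · simpa [hβdef] using hc0
    · simp only [hβdef]
      split_ifs
      · exact hu
      · simpa using hc0
  obtain ⟨θ, hθ, hθx⟩ := exists_params_of_layers h0 h1 u v hparams hc0 hW hβ
  refine ⟨θ, hθ, fun x => ?_⟩
  set z : ℕ → ℝ := fun q => f q - u - L * ∑ i ∈ Finset.range d, |param x i - p q i| with hz
  set ω : ℕ → ℝ := fun q => if q < N then rect (z q) else 0 with hω
  have hω0 : ∀ q, 0 ≤ ω q := fun q => by
    simp only [hω]; split_ifs; exacts [rect_nonneg _, le_rfl]
  -- The intended hidden states, defined for all indices; cones with index at least `N` count as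
  -- zero, so surplus neurons and surplus layers do no harm.
  set h : ℕ → ℕ → ℝ := fun k i => match k with
    | 0 => param x i
    | 1 => coneLayer N d p (param x) i
    | 2 => match i with
      | 0 => rect (z 0 - z 1)
      | 1 => rect (z 1)
      | 2 => rect (-z 1)
      | i + 3 => ω (i + 2)
    | k + 3 => match i with
      | 0 => rect (runMax N z k - ω (k + 2))
      | i + 1 => ω (k + 2 + i) with hhdef
  have hh0 : ∀ j, l 0 ≤ j → h 0 j = 0 := fun j hj => by
    simp only [hhdef, param]; exact dif_neg (by omega)
  have hh2 : ∀ j, l 2 ≤ j → h 2 j = 0 := by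
    rintro (_ | _ | _ | j) hj
    · omega
    · omega
    · omega
    · simp only [hhdef, hω]; exact if_neg (by omega)
  have hh3 : ∀ k < r + 1, ∀ j, l (k + 3) ≤ j → h (k + 3) j = 0 := by
    rintro k hk (_ | j) hj
    · have := hli (k + 3) (by omega) (by omega); omega
    · have := hli (k + 3) (by omega) (by omega)
      simp only [hhdef, hω]; exact if_neg (by omega)
  have hrun : ∀ k, h (k + 3) 0 + h (k + 3) 1 = runMax N z (k + 1) := fun k => by
    simp only [hhdef, runMax, add_zero]
    exact rect_sub_add _ _
  have hcone : ∀ q < N, ∑ j ∈ Finset.range (l 1), coneWeight N d L q j * h 1 j + (f q - u)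
      = z q := fun q hq => by
    simp only [hhdef]
    rw [sum_coneWeight_mul_coneLayer hd hl1 hq]
    simp only [hz]; ring
  have hfinal := hθx x h (fun i _ => rfl) ?_
  · rw [hfinal]
    have e1 : ∑ j ∈ Finset.range (l (r + 3)), W (r + 3) 0 j * h (r + 3) j
        = runMax N z (r + 1) := by
      simp only [hWdef, if_true, sub_zero, he, add_mul, Finset.sum_add_distrib]
      rw [sum_range_single (hh3 r (by omega)), sum_range_single (hh3 r (by omega)), hrun]
    have e2 : β (r + 3) 0 = u := by simp [hβdef]
    rw [e1, e2]
    rfl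
  · intro n hn i hi
    rcases n with _ | _ | _ | k
    · simp only [hWdef, hβdef]
      change coneLayer N d p (param x) i = _
      unfold coneLayer
      split_ifs
      · simp only [he]
        rw [sum_range_single hh0]; rfl
      · simp only [he, neg_mul, Finset.sum_neg_distrib]
        rw [sum_range_single hh0]
        congr 1
        simp only [hhdef]; ring
      · simp [rect]
    · rcases i with _ | _ | _ | i
      · simp only [hWdef, hβdef]
        change rect (z 0 - z 1) = _
        rw [← hcone 0 (by omega), ← hcone 1 (by omega)]
        simp only [sub_mul, Finset.sum_sub_distrib]
        congr 1; ring
      · simp only [hWdef, hβdef]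
        change rect (z 1) = _
        rw [← hcone 1 (by omega)]
      · simp only [hWdef, hβdef]
        change rect (-z 1) = _
        rw [← hcone 1 (by omega)]
        simp only [neg_mul, Finset.sum_neg_distrib]
        congr 1; ring
      · simp only [hWdef, hβdef]
        change (if i + 2 < N then rect (z (i + 2)) else 0) = _
        split_ifs with hiN
        · rw [← hcone _ hiN]
        · simp [rect]
    · rcases i with _ | i
      · simp only [hWdef, hβdef, he, add_mul, sub_mul, Finset.sum_add_distrib,
          Finset.sum_sub_distrib]
        rw [sum_range_single hh2, sum_range_single hh2, sum_range_single hh2, sum_range_single hh2]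
        change rect (max (z 0) (z 1) - ω 2)
          = rect (rect (z 0 - z 1) + rect (z 1) - rect (-z 1) - ω 2 + 0)
        rw [add_sub_assoc, rect_sub_rect_neg, rect_sub_add, add_zero]
      · simp only [hWdef, hβdef, he]
        rw [sum_range_single hh2]
        change ω (0 + 2 + i) = rect (ω (i + 2) + 0)
        rw [add_zero, rect_of_nonneg (hω0 _)]
        congr 1; omega
    · have hkr : k ≠ r := by omega
      have hv := hh3 k (by omega)
      rcases i with _ | i
      · simp only [hWdef, hβdef, he, add_mul, sub_mul, Finset.sum_add_distrib, if_neg hkr,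
          Finset.sum_sub_distrib]
        rw [sum_range_single hv, sum_range_single hv, sum_range_single hv, hrun]
        change rect (runMax N z (k + 1) - ω (k + 1 + 2)) = rect (_ - ω (k + 2 + 1) + 0)
        rw [add_zero]
      · simp only [hWdef, hβdef, he, if_neg hkr]
        rw [sum_range_single hv]
        change ω (k + 1 + 2 + i) = rect (ω (k + 2 + (i + 1)) + 0)
        rw [add_zero, rect_of_nonneg (hω0 _)]
        congr 1; omega

lemma le_runMax {N : ℕ} {z : ℕ → ℝ} {k q : ℕ} (hq : q < N) (hk : q ≤ k + 1) :
    z q ≤ runMax N z k := by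
  induction k with
  | zero =>
    have : q = 0 ∨ q = 1 := by omega
    rcases this with rfl | rfl
    exacts [le_max_left _ _, le_max_right _ _]
  | succ k ih =>
    rcases Nat.le_succ_iff.1 hk with h | rfl
    · exact (ih h).trans (le_max_left _ _)
    · refine le_trans ?_ (le_max_right _ _)
      rw [if_pos hq]
      exact le_max_left _ _

/-- Taking positive parts cannot overshoot a nonnegative bound. It is applied with `y = E x - u`,
which is why the cones are shifted by `u`. -/
lemma runMax_le {N : ℕ} {z : ℕ → ℝ} {y : ℝ} (hy : 0 ≤ y) (hN : 2 ≤ N) (hz : ∀ q < N, z q ≤ y)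
    (k : ℕ) : runMax N z k ≤ y := by
  induction k with
  | zero => exact max_le (hz _ (by omega)) (hz _ (by omega))
  | succ k ih =>
    refine max_le ih ?_
    split_ifs with h
    exacts [max_le (hz _ h) hy, hy]

end Cones

/-! ### Approximation of Lipschitz functions by maxima of cones on a grid. -/

section Approximation

/-- The midpoint of the `t`-th of `n` intervals of equal length that partition `[a, b]`. -/
noncomputable def gridPt (a b : ℝ) (n t : ℕ) : ℝ := a + (b - a) * (2 * t + 1) / (2 * n)

lemma gridPt_mem {a b : ℝ} (hab : a ≤ b) {n t : ℕ} (ht : t < n) : gridPt a b n t ∈ Set.Icc a b := by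
  have hn : (0 : ℝ) < n := by exact_mod_cast (Nat.zero_le t).trans_lt ht
  have ht' : (t : ℝ) + 1 ≤ n := by exact_mod_cast ht
  have hba : 0 ≤ b - a := sub_nonneg.2 hab
  refine ⟨by unfold gridPt; linarith [show 0 ≤ (b - a) * (2 * t + 1) / (2 * n) by positivity], ?_⟩
  have : (b - a) * (2 * t + 1) / (2 * n) ≤ b - a := by
    rw [div_le_iff₀ (by positivity)]
    exact mul_le_mul_of_nonneg_left (by linarith) hba
  unfold gridPt; linarith

lemma exists_gridPt_near {a b y : ℝ} (hab : a < b) (hy : y ∈ Set.Icc a b) {n : ℕ} (hn : 1 ≤ n) :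
    ∃ t : Fin n, |y - gridPt a b n t| ≤ (b - a) / (2 * n) := by
  have hn0 : (0 : ℝ) < n := by exact_mod_cast hn
  have hba : 0 < b - a := sub_pos.2 hab
  set s := (y - a) / (b - a) * n with hs
  have hs0 : 0 ≤ s := mul_nonneg (div_nonneg (by linarith [hy.1]) hba.le) hn0.le
  have hsn : s ≤ n := by
    have : (y - a) / (b - a) ≤ 1 := (div_le_one hba).2 (by linarith [hy.2])
    nlinarith
  have hys : y = a + (b - a) * s / n := by
    rw [hs]; field_simp; ring
  obtain ⟨t, ht1, ht2⟩ : ∃ t : Fin n, (t : ℝ) ≤ s ∧ s ≤ t + 1 := by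
    -- The right endpoint `y = b` has `s = n` and is assigned to the last cell.
    by_cases h : ⌊s⌋₊ < n
    · exact ⟨⟨_, h⟩, Nat.floor_le hs0, (Nat.lt_floor_add_one s).le⟩
    · have h' : (n : ℝ) ≤ s := (Nat.le_floor_iff hs0).1 (not_lt.1 h)
      refine ⟨⟨n - 1, by omega⟩, ?_, ?_⟩ <;> push_cast [Nat.cast_sub hn] <;> linarith
  refine ⟨t, ?_⟩
  have e : y - gridPt a b n t = (b - a) / (2 * n) * (2 * s - 2 * t - 1) := by
    rw [gridPt]; nth_rewrite 1 [hys]; field_simp; ring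
  rw [e, abs_mul, abs_of_nonneg (by positivity)]
  refine mul_le_of_le_one_right (by positivity) ?_
  rw [abs_le]; constructor <;> linarith

lemma two_mul_le_two_pow {d : ℕ} (hd : 1 ≤ d) : 2 * d ≤ 2 ^ d := by
  induction d, hd using Nat.le_induction with
  | base => simp
  | succ d hd ih => rw [pow_succ]; omega

lemma abs_le_of_mem_cube {d : ℕ} {a b c : ℝ} (ha : |a| ≤ c) (hb : |b| ≤ c) (x : cube d a b)
    (i : Fin d) : |(x : Fin d → ℝ) i| ≤ c :=
  abs_le.2 ⟨(neg_le_of_abs_le ha).trans (x.2.1 i), (x.2.2 i).trans ((le_abs_self b).trans hb)⟩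

lemma abs_param_le {D : ℕ} {θ : Fin D → ℝ} {c : ℝ} (hc : 0 ≤ c) (h : ∀ i, |θ i| ≤ c) (k : ℕ) :
    |param θ k| ≤ c := by
  unfold param
  split_ifs
  exacts [h _, by simpa using hc]

lemma lipschitz_const_nonneg {d : ℕ} (hd : 1 ≤ d) {a b u v L : ℝ} (hab : a < b)
    {E : cube d a b → Set.Icc u v} (hLip : ∀ x y : cube d a b,
      |(E x : ℝ) - (E y : ℝ)| ≤ L * ∑ i : Fin d, |(x : Fin d → ℝ) i - (y : Fin d → ℝ) i|) :
    0 ≤ L := by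
  have h := hLip ⟨fun _ => b, fun _ => hab.le, fun _ => le_rfl⟩
    ⟨fun _ => a, fun _ => le_rfl, fun _ => hab.le⟩
  simp only [Finset.sum_const, Finset.card_univ, Fintype.card_fin, nsmul_eq_mul] at h
  have hd' : (0 : ℝ) < d := by exact_mod_cast hd
  have hpos : 0 < (d : ℝ) * |b - a| := mul_pos hd' (abs_pos.2 (sub_pos.2 hab).ne')
  exact nonneg_of_mul_nonneg_left ((abs_nonneg _).trans h) hpos

lemma exists_params_const {D d depth : ℕ} {l : ℕ → ℕ} (h0 : l 0 = d) (h1 : l depth = 1)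
    (hdepth : 1 ≤ depth) (hparams : numParams l depth ≤ D) {u v c e : ℝ} (he : |e| ≤ c) :
    ∃ θ : Fin D → ℝ, (∀ i, |θ i| ≤ c) ∧ ∀ x : Fin d → ℝ, realNN h0 h1 u v θ x = clip u v e := by
  obtain ⟨k, rfl⟩ : ∃ k, depth = k + 1 := ⟨depth - 1, by omega⟩
  have hc : 0 ≤ c := (abs_nonneg e).trans he
  obtain ⟨θ, hθ, hx⟩ := exists_params_of_layers h0 h1 u v hparams (W := fun _ _ _ => 0)
    (β := fun _ _ => e) hc (by simpa using hc) (fun _ _ => he)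
  refine ⟨θ, hθ, fun x => ?_⟩
  rw [hx x (fun n i => match n with
    | 0 => param x i
    | _ + 1 => rect e) (fun _ _ => rfl) (by simp)]
  simp

/-- Take `n = ⌊r / 2⌋` with `r = A^(1/d) > 6`. Then `n ≥ 3`, hence `r < 2n + 2 ≤ 3n`, while `2d ≤
2^d` gives `2d n^d ≤ r^d = A`. -/
lemma exists_grid_size {A : ℝ} {d : ℕ} (hd : 1 ≤ d) (hA : (6 : ℝ) ^ d < A) :
    ∃ n : ℕ, 3 ≤ n ∧ A ^ ((1 : ℝ) / d) / 3 ≤ n ∧ (2 : ℝ) * d * n ^ d ≤ A := by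
  have hd0 : (d : ℝ) ≠ 0 := by exact_mod_cast (by omega : d ≠ 0)
  have hA0 : 0 < A := (by positivity : (0 : ℝ) < 6 ^ d).trans hA
  set r := A ^ ((1 : ℝ) / d) with hr
  have hrd : r ^ d = A := by
    rw [hr, ← Real.rpow_natCast, ← Real.rpow_mul hA0.le, one_div_mul_cancel hd0, Real.rpow_one]
  have hr0 : 0 ≤ r := Real.rpow_nonneg hA0.le _
  have hr6 : 6 < r := lt_of_pow_lt_pow_left₀ d hr0 (hrd ▸ hA)
  have h3 : 3 ≤ ⌊r / 2⌋₊ := Nat.le_floor (by push_cast; linarith)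
  have hfl : (⌊r / 2⌋₊ : ℝ) ≤ r / 2 := Nat.floor_le (by positivity)
  refine ⟨⌊r / 2⌋₊, h3, ?_, ?_⟩
  · have := Nat.lt_floor_add_one (r / 2)
    have h3' : (3 : ℝ) ≤ ⌊r / 2⌋₊ := by exact_mod_cast h3
    linarith
  · have h2 : (2 : ℝ) * d ≤ 2 ^ d := by exact_mod_cast two_mul_le_two_pow hd
    calc (2 : ℝ) * d * (⌊r / 2⌋₊ : ℝ) ^ d ≤ 2 ^ d * (r / 2) ^ d := by gcongr
      _ = A := by rw [← mul_pow, mul_div_cancel₀ _ two_ne_zero, hrd]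

/-- Approximation of Lipschitz functions by rectified clipped networks. -/
theorem exists_params_approx {D d depth : ℕ} {l : ℕ → ℕ} (h0 : l 0 = d) (h1 : l depth = 1)
    (hd : 1 ≤ d) (hdepth : 1 ≤ depth) (hparams : numParams l depth ≤ D)
    {A L a b u v c : ℝ} (hA : 0 < A) (hab : a < b)
    (hc1 : 1 ≤ c) (hcL : L ≤ c) (hca : |a| ≤ c) (hcb : |b| ≤ c) (hcu : 2 * |u| ≤ c)
    (hcv : 2 * |v| ≤ c)
    (hdepthA : A * (Set.Ioi ((6 : ℝ) ^ d)).indicator 1 A / (2 * d) + 1 ≤ (depth : ℝ))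
    (hl1 : A * (Set.Ioi ((6 : ℝ) ^ d)).indicator 1 A ≤ (l 1 : ℝ))
    (hli : ∀ i : ℕ, 2 ≤ i → i < depth →
      (Set.Ioi ((6 : ℝ) ^ d)).indicator 1 A * max (A / d - 2 * i + 3) 2 ≤ (l i : ℝ))
    {E : cube d a b → Set.Icc u v} (hLip : ∀ x y : cube d a b,
      |(E x : ℝ) - (E y : ℝ)| ≤ L * ∑ i : Fin d, |(x : Fin d → ℝ) i - (y : Fin d → ℝ) i|) :
    ∃ θ : Fin D → ℝ, (∀ i, |θ i| ≤ c) ∧ ∀ x : cube d a b,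
      |realNN h0 h1 u v θ x - (E x : ℝ)| ≤ 3 * d * L * (b - a) / A ^ ((1 : ℝ) / d) := by
  have hL := lipschitz_const_nonneg hd hab hLip
  have hba : 0 < b - a := sub_pos.2 hab
  have hd0 : (0 : ℝ) < d := by exact_mod_cast hd
  have hr0 : 0 < A ^ ((1 : ℝ) / d) := Real.rpow_pos_of_pos hA _
  have hclip : ∀ (y : ℝ) (x : cube d a b), |clip u v y - (E x : ℝ)| ≤ |y - E x| := fun y x => by
    simpa only [clip_of_mem (E x).2] using abs_clip_sub_clip_le u v y (E x)
  have hE : ∀ x, |(E x : ℝ)| ≤ c / 2 := fun x => by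
    have := (E x).2
    rw [abs_le]
    constructor
    · linarith [this.1, neg_le_of_abs_le (le_refl |u|)]
    · linarith [this.2, le_abs_self v]
  by_cases hA6 : (6 : ℝ) ^ d < A
  · obtain ⟨n, hn3, hnA, hnd⟩ := exists_grid_size hd hA6
    have hind : (Set.Ioi ((6 : ℝ) ^ d)).indicator 1 A = (1 : ℝ) :=
      Set.indicator_of_mem (Set.mem_Ioi.2 hA6) _
    simp only [hind, mul_one, one_mul] at hdepthA hl1 hli
    set N := n ^ d with hNdef
    have hNn : n ≤ N := Nat.le_self_pow (by omega) n
    have hNA : (N : ℝ) ≤ A / (2 * d) := by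
      rw [le_div_iff₀ (by positivity), hNdef]; push_cast; linarith
    have hNA2 : 2 * (N : ℝ) ≤ A / d := by
      have : A / (2 * d) = A / d / 2 := by rw [mul_comm, div_mul_eq_div_div]
      linarith
    have hdepthN : N + 1 ≤ depth := by
      have : (N : ℝ) + 1 ≤ depth := by linarith
      exact_mod_cast this
    have hw1 : 2 * (N * d) ≤ l 1 := by
      have : (2 : ℝ) * (N * d) ≤ l 1 := by
        rw [hNdef]; push_cast; linarith
      exact_mod_cast this
    have hw2 : N + 1 ≤ l 2 := by
      have := (le_max_left _ _).trans (hli 2 le_rfl (by omega))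
      have h' : 2 * (N : ℝ) ≤ l 2 + 1 := by push_cast at this; linarith
      have : 2 * N ≤ l 2 + 1 := by exact_mod_cast h'
      omega
    have hwi : ∀ k, 3 ≤ k → k < depth → 2 ≤ l k ∧ N + 2 ≤ l k + k := by
      intro k hk hkd
      have h2 := (le_max_right _ _).trans (hli k (by omega) hkd)
      have h3 := (le_max_left _ _).trans (hli k (by omega) hkd)
      have h2' : 2 ≤ l k := by exact_mod_cast h2
      have h3' : 2 * (N : ℝ) + 3 ≤ l k + 2 * k := by linarith
      have h3n : 2 * N + 3 ≤ l k + 2 * k := by exact_mod_cast h3'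
      exact ⟨h2', by omega⟩
    -- The default corner serves only to keep the bounds on centres and values valid for all `q`;
    -- only `q < N` enters the maximum.
    set pt : ℕ → cube d a b := fun q => if hq : q < n ^ d then
      ⟨fun i => gridPt a b n (finFunctionFinEquiv.symm ⟨q, hq⟩ i),
        fun i => (gridPt_mem hab.le (Fin.is_lt _)).1, fun i => (gridPt_mem hab.le (Fin.is_lt _)).2⟩
      else ⟨fun _ => a, fun _ => le_rfl, fun _ => hab.le⟩ with hpt
    obtain ⟨θ, hθ, hθx⟩ := exists_params_max_cones (u := u) (v := v) (c := c) (L := L) h0 h1 hd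
      hparams (hn3.trans hNn) hdepthN hw1 hw2 hwi hL hcL hc1 (by linarith [abs_nonneg u])
      (p := fun q i => param (pt q : Fin d → ℝ) i) (f := fun q => E (pt q))
      (fun q i => abs_param_le (by linarith) (abs_le_of_mem_cube hca hcb _) i)
      -- Biases are differences of two values in `[u, v]`, each of modulus at most `c / 2`; this is
      -- the purpose of `2|u|, 2|v| ≤ c`.
      (fun q => by
        refine (abs_sub _ _).trans ?_
        linarith [hE (pt q)])
      (fun q q' => by
        refine (abs_sub _ _).trans ?_
        linarith [hE (pt q), hE (pt q')])
    refine ⟨θ, hθ, fun x => ?_⟩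
    rw [hθx]
    refine (hclip _ x).trans ?_
    set z : ℕ → ℝ := fun q => (E (pt q) : ℝ) - u -
      L * ∑ i ∈ Finset.range d, |param (x : Fin d → ℝ) i - param (pt q : Fin d → ℝ) i| with hz
    have hsum : ∀ q, ∑ i ∈ Finset.range d,
        |param (x : Fin d → ℝ) i - param (pt q : Fin d → ℝ) i|
          = ∑ i : Fin d, |(x : Fin d → ℝ) i - (pt q : Fin d → ℝ) i| := fun q => by
      rw [Finset.sum_range]
      simp [param]
    -- By the Lipschitz condition every cone lies below `E`.
    have hupper : runMax N z (depth - 3) + u ≤ E x := by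
      have := runMax_le (N := N) (z := z) (y := E x - u) (by linarith [(E x).2.1]) (by omega)
        (fun q _ => by
          have := (abs_le.1 (hLip x (pt q))).1
          simp only [hz, hsum]
          linarith) (depth - 3)
      linarith
    obtain ⟨t, ht⟩ : ∃ t : Fin d → Fin n, ∀ i,
        |(x : Fin d → ℝ) i - gridPt a b n (t i)| ≤ (b - a) / (2 * n) := by
      choose t ht using fun i => exists_gridPt_near hab ⟨x.2.1 i, x.2.2 i⟩ (by omega : 1 ≤ n)
      exact ⟨t, ht⟩
    set q := finFunctionFinEquiv t with hq
    have hptq : ∀ i, (pt q : Fin d → ℝ) i = gridPt a b n (t i) := fun i => by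
      simp only [hpt]
      rw [dif_pos q.2]
      simp only [Fin.eta, hq, Equiv.symm_apply_apply]
    have hdist : ∑ i : Fin d, |(x : Fin d → ℝ) i - (pt q : Fin d → ℝ) i|
        ≤ d * ((b - a) / (2 * n)) := by
      refine (Finset.sum_le_card_nsmul _ _ ((b - a) / (2 * n)) fun i _ => ?_).trans (by simp)
      rw [hptq]; exact ht i
    -- The cone at a near grid point loses `L` times the distance twice: in its slope and in the
    -- value of `E` at its tip.
    have hlower : E x - 2 * (L * (d * ((b - a) / (2 * n)))) ≤ runMax N z (depth - 3) + u := by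
      have h2 := le_runMax (N := N) (z := z) (k := depth - 3) (q := q) q.2
        (by have : (q : ℕ) < N := q.2
            omega)
      have h3 := (abs_le.1 (hLip x (pt q))).2
      have h4 := mul_le_mul_of_nonneg_left hdist hL
      have h5 : z q = (E (pt q) : ℝ) - u -
          L * ∑ i : Fin d, |(x : Fin d → ℝ) i - (pt q : Fin d → ℝ) i| := by
        simp only [hz, hsum]
      linarith
    have hn0 : (0 : ℝ) < n := by exact_mod_cast (by omega : 0 < n)
    have hfin : 2 * (L * (d * ((b - a) / (2 * n)))) ≤ 3 * d * L * (b - a) / A ^ ((1 : ℝ) / d) := by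
      have : 2 * (L * (d * ((b - a) / (2 * n)))) = d * L * (b - a) / n := by
        field_simp
      rw [this, div_le_div_iff₀ hn0 hr0]
      have h6 : 0 ≤ d * L * (b - a) := by positivity
      nlinarith
    rw [abs_le]; constructor <;> linarith
  -- For `A ≤ 6^d` the value of `E` at the centre suffices: its error `dL(b - a)/2` is within the
  -- claim because `A^(1/d) ≤ 6`.
  · have hmid : ∀ _ : Fin d, (a + b) / 2 ∈ Set.Icc a b := fun _ => ⟨by linarith, by linarith⟩
    set m : cube d a b := ⟨fun _ => (a + b) / 2, fun i => (hmid i).1, fun i => (hmid i).2⟩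
    obtain ⟨θ, hθ, hθx⟩ := exists_params_const (D := D) (u := u) (v := v) h0 h1 hdepth hparams
      (e := E m) (c := c) (by linarith [hE m])
    refine ⟨θ, hθ, fun x => ?_⟩
    rw [hθx]
    refine (hclip _ x).trans ((hLip m x).trans ?_)
    have hdist : ∑ i : Fin d, |(m : Fin d → ℝ) i - (x : Fin d → ℝ) i| ≤ d * ((b - a) / 2) := by
      refine (Finset.sum_le_card_nsmul _ _ ((b - a) / 2) fun i _ => ?_).trans (by simp)
      have h1 := x.2.1 i
      have h2 := x.2.2 i
      rw [abs_le]; constructor <;> simp only [m] <;> linarith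
    refine (mul_le_mul_of_nonneg_left hdist hL).trans ?_
    have hr6 : A ^ ((1 : ℝ) / d) ≤ 6 := by
      calc A ^ ((1 : ℝ) / d) ≤ ((6 : ℝ) ^ d) ^ ((1 : ℝ) / d) :=
            Real.rpow_le_rpow hA.le (not_lt.1 hA6) (by positivity)
        _ = 6 := by
            rw [← Real.rpow_natCast, ← Real.rpow_mul (by norm_num), mul_one_div_cancel hd0.ne',
              Real.rpow_one]
    rw [le_div_iff₀ hr0]
    have h6 : 0 ≤ L * (d * ((b - a) / 2)) := by positivity
    nlinarith

end Approximation

/-! ### Moments from exponential tails. -/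

section Moments

/-- On `(0, 1]` convexity and `Γ(1) = Γ(2) = 1` give the bound `1`; the functional equation then
carries it from one unit interval to the next. -/
lemma Gamma_add_one_le_rpow {q : ℝ} (hq : 0 < q) : Real.Gamma (q + 1) ≤ (max 1 q) ^ q := by
  have key : ∀ (n : ℕ) (q : ℝ), 0 < q → q ≤ n + 1 → Real.Gamma (q + 1) ≤ (max 1 q) ^ q := by
    intro n
    induction n with
    | zero =>
      intro q hq hq1
      norm_num at hq1
      have h := Real.convexOn_Gamma.2 (x := 1) (y := 2) (by simp) (by simp)
        (sub_nonneg.2 hq1) hq.le (by ring)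
      simp only [smul_eq_mul, Real.Gamma_one, Real.Gamma_two] at h
      rw [max_eq_left hq1, Real.one_rpow]
      calc Real.Gamma (q + 1) = Real.Gamma ((1 - q) * 1 + q * 2) := by congr 1; ring
        _ ≤ 1 := h.trans_eq (by ring)
    | succ n ih =>
      intro q hq hqn
      rcases le_or_gt q 1 with h1 | h1
      · exact ih q hq (by linarith [(Nat.cast_nonneg n : (0 : ℝ) ≤ n)])
      · have h := ih (q - 1) (by linarith) (by push_cast at hqn; linarith)
        rw [sub_add_cancel] at h
        rw [Real.Gamma_add_one hq.ne', max_eq_right h1.le]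
        calc q * Real.Gamma q ≤ q * (max 1 (q - 1)) ^ (q - 1) := by gcongr
          _ ≤ q * q ^ (q - 1) := by
              gcongr
              exact max_le h1.le (by linarith)
          _ = q ^ q := by
              rw [Real.rpow_sub_one hq.ne']; field_simp
  exact key ⌈q⌉₊ q hq ((Nat.le_ceil q).trans (by linarith))

variable {Ω : Type*} [MeasurableSpace Ω] {μ : Measure Ω}

/-- Moments of a nonnegative random variable whose tails decay like `exp (-b * t ^ δ)`. -/
lemma lintegral_rpow_le_of_tail {f : Ω → ℝ} (hf0 : ∀ ω, 0 ≤ f ω) (hf : Measurable f)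
    {C b δ q : ℝ} (hC : 0 ≤ C) (hb : 0 < b) (hδ : 0 < δ) (hq : 0 < q)
    (htail : ∀ t, 0 < t → μ {ω | t < f ω} ≤ ENNReal.ofReal (C * Real.exp (-b * t ^ δ))) :
    ∫⁻ ω, ENNReal.ofReal (f ω ^ q) ∂μ
      ≤ ENNReal.ofReal (C * b ^ (-q / δ) * Real.Gamma (q / δ + 1)) := by
  -- Layer-cake formula; the tail bound turns the integral into a Gamma integral.
  rw [lintegral_rpow_eq_lintegral_meas_lt_mul μ (Filter.Eventually.of_forall hf0) hf.aemeasurable hq]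
  have hI := integrableOn_rpow_mul_exp_neg_mul_rpow (s := q - 1) (p := δ) (b := b) (by linarith)
    hδ hb
  have h1 : ∫⁻ t in Set.Ioi (0 : ℝ), μ {ω | t < f ω} * ENNReal.ofReal (t ^ (q - 1))
      ≤ ∫⁻ t in Set.Ioi (0 : ℝ), ENNReal.ofReal (C * (t ^ (q - 1) * Real.exp (-b * t ^ δ))) := by
    refine setLIntegral_mono' measurableSet_Ioi fun t ht => ?_
    have ht : 0 < t := ht
    refine (mul_le_mul_left (htail t ht) _).trans_eq ?_
    rw [← ENNReal.ofReal_mul (by positivity)]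
    congr 1; ring
  refine (mul_le_mul_right h1 _).trans_eq ?_
  rw [← ofReal_integral_eq_lintegral_ofReal (hI.const_mul C), integral_const_mul,
    integral_rpow_mul_exp_neg_mul_rpow hδ (by linarith) hb, ← ENNReal.ofReal_mul hq.le,
    sub_add_cancel, Real.Gamma_add_one (by positivity)]
  · congr 1; ring
  · filter_upwards [ae_restrict_mem measurableSet_Ioi] with t ht
    have ht : 0 < t := ht
    positivity

lemma eLpNorm_le_of_lintegral_rpow_le {f : Ω → ℝ} (hf0 : ∀ ω, 0 ≤ f ω) {p B : ℝ} (hp : 0 < p)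
    (hB : 0 ≤ B) (h : ∫⁻ ω, ENNReal.ofReal (f ω ^ p) ∂μ ≤ ENNReal.ofReal (B ^ p)) :
    eLpNorm f (ENNReal.ofReal p) μ ≤ ENNReal.ofReal B := by
  rw [eLpNorm_eq_lintegral_rpow_enorm_toReal (by simpa using hp) ENNReal.ofReal_ne_top,
    ENNReal.toReal_ofReal hp.le]
  calc (∫⁻ ω, ‖f ω‖ₑ ^ p ∂μ) ^ (1 / p) = (∫⁻ ω, ENNReal.ofReal (f ω ^ p) ∂μ) ^ (1 / p) := by
        congr 1
        refine lintegral_congr fun ω => ?_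
        rw [Real.enorm_of_nonneg (hf0 ω), ENNReal.ofReal_rpow_of_nonneg (hf0 ω) hp.le]
    _ ≤ (ENNReal.ofReal (B ^ p)) ^ (1 / p) := by gcongr
    _ = ENNReal.ofReal B := by
        rw [ENNReal.ofReal_rpow_of_nonneg (by positivity) (by positivity), ← Real.rpow_mul hB,
          mul_one_div_cancel hp.ne', Real.rpow_one]

end Moments

/-! ### The best of several uniform samples. -/

section MonteCarlo

variable {Ω : Type*} [MeasurableSpace Ω] {P : Measure Ω} {D : ℕ}

/-- The maximum distance of the first `n` coordinates. -/
noncomputable def headDist (n : ℕ) (ϑ θ : Fin D → ℝ) : ℝ :=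
  ‖fun i : Fin D => if (i : ℕ) < n then θ i - ϑ i else 0‖

lemma headDist_nonneg (n : ℕ) (ϑ θ : Fin D → ℝ) : 0 ≤ headDist n ϑ θ := norm_nonneg _

lemma continuous_headDist (n : ℕ) (ϑ : Fin D → ℝ) : Continuous (headDist n ϑ) := by
  refine continuous_norm.comp (continuous_pi fun i => ?_)
  split_ifs <;> fun_prop

lemma headDist_le_iff {n : ℕ} {ϑ θ : Fin D → ℝ} {t : ℝ} (ht : 0 ≤ t) :
    headDist n ϑ θ ≤ t ↔ ∀ i : Fin D, (i : ℕ) < n → |θ i - ϑ i| ≤ t := by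
  unfold headDist
  rw [pi_norm_le_iff_of_nonneg ht]
  refine forall_congr' fun i => ?_
  split_ifs with h <;> simp [h, ht]

lemma abs_param_sub_le_headDist {n : ℕ} {ϑ θ : Fin D → ℝ} {k : ℕ} (hk : k < n) :
    |param θ k - param ϑ k| ≤ headDist n ϑ θ := by
  unfold param
  split_ifs with h
  · exact (headDist_le_iff (headDist_nonneg n ϑ θ)).1 le_rfl ⟨k, h⟩ hk
  · simpa using headDist_nonneg n ϑ θ

/-- Even if `ϑ i` is an endpoint of `[-c, c]`, the points of that interval within `t` of `ϑ i` form
an interval of length at least `t`, not necessarily `2t`. Coordinates from `n` on are unrestricted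
and contribute the factor one. -/
lemma uniform_headDist_le {n : ℕ} (hn : n ≤ D) {c t : ℝ} (hc : 0 < c) (ht : 0 ≤ t)
    (htc : t ≤ 2 * c) {ϑ : Fin D → ℝ} (hϑ : ∀ i, |ϑ i| ≤ c) :
    ENNReal.ofReal ((t / (2 * c)) ^ n)
      ≤ (volume : Measure (Fin D → ℝ))[{θ | headDist n ϑ θ ≤ t} | cube D (-c) c] := by
  rw [cond_apply measurableSet_Icc]
  set lo : Fin D → ℝ := fun i => if (i : ℕ) < n then max (-c) (ϑ i - t) else -c
  set hi : Fin D → ℝ := fun i => if (i : ℕ) < n then min c (ϑ i + t) else c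
  have hsub : Set.Icc lo hi ⊆ cube D (-c) c ∩ {θ | headDist n ϑ θ ≤ t} := by
    intro θ hθ
    have h : ∀ i, lo i ≤ θ i ∧ θ i ≤ hi i := fun i => ⟨hθ.1 i, hθ.2 i⟩
    refine ⟨⟨fun i => ?_, fun i => ?_⟩, (headDist_le_iff ht).2 fun i hin => ?_⟩
    · refine le_trans ?_ (h i).1
      simp only [lo]; split_ifs
      exacts [le_max_left _ _, le_rfl]
    · refine (h i).2.trans ?_
      simp only [hi]; split_ifs
      exacts [min_le_left _ _, le_rfl]
    · have h' := h i
      simp only [lo, hi, if_pos hin] at h'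
      rw [abs_le]
      constructor
      · linarith [(le_max_right (-c) (ϑ i - t)).trans h'.1]
      · linarith [h'.2.trans (min_le_right c (ϑ i + t))]
  refine le_trans ?_ (mul_le_mul_right (measure_mono hsub) _)
  rw [Real.volume_Icc_pi, Real.volume_Icc_pi, ← ENNReal.ofReal_prod_of_nonneg (by
    intro i _; linarith)]
  have hlen : ∀ i : Fin D, (if (i : ℕ) < n then t else 2 * c) ≤ hi i - lo i := by
    intro i
    have hϑi := abs_le.1 (hϑ i)
    simp only [lo, hi]
    split_ifs
    · rw [le_sub_iff_add_le, ← le_sub_iff_add_le', max_le_iff, le_sub_iff_add_le, le_sub_iff_add_le,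
        le_min_iff, le_min_iff]
      refine ⟨⟨?_, ?_⟩, ?_, ?_⟩ <;> linarith
    · linarith
  have h0 : ∀ i : Fin D, 0 ≤ (if (i : ℕ) < n then t else 2 * c) := fun i => by
    split_ifs <;> linarith
  rw [← ENNReal.ofReal_prod_of_nonneg (fun i _ => (h0 i).trans (hlen i)),
    ← ENNReal.ofReal_inv_of_pos (Finset.prod_pos fun i _ => by linarith),
    ← ENNReal.ofReal_mul (inv_nonneg.2 (Finset.prod_nonneg fun i _ => by linarith))]
  refine ENNReal.ofReal_le_ofReal ?_
  rw [← Finset.prod_inv_distrib, ← Finset.prod_mul_distrib]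
  have hcard : (Finset.univ.filter fun i : Fin D => (i : ℕ) < n).card = n := by
    rw [Fin.card_filter_val_lt, min_eq_right hn]
  calc (t / (2 * c)) ^ n = ∏ i : Fin D, if (i : ℕ) < n then t / (2 * c) else 1 := by
        rw [Finset.prod_ite]; simp only [Finset.prod_const, hcard, one_pow, mul_one]
    _ ≤ _ := by
        refine Finset.prod_le_prod (fun i _ => by split_ifs <;> positivity) fun i _ => ?_
        rw [sub_neg_eq_add, ← two_mul]
        refine le_trans ?_ (mul_le_mul_of_nonneg_left (hlen i) (by positivity))
        split_ifs
        · rw [div_eq_inv_mul]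
        · rw [inv_mul_cancel₀ (by positivity)]

lemma measurable_min_headDist {ι : Type*} [Fintype ι] [Nonempty ι] {Θ : ι → Ω → Fin D → ℝ}
    (hΘ : ∀ k, Measurable (Θ k)) (n : ℕ) (ϑ : Fin D → ℝ) :
    Measurable fun ω => Finset.univ.inf' Finset.univ_nonempty fun k => headDist n ϑ (Θ k ω) := by
  have h : Measurable (Finset.univ.inf' Finset.univ_nonempty fun k ω => headDist n ϑ (Θ k ω)) :=
    Finset.inf'_induction _ _ (fun _ h₁ _ h₂ => h₁.inf h₂) fun k _ =>
      (continuous_headDist n ϑ).measurable.comp (hΘ k)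
  convert h using 1
  ext ω
  simp [Finset.inf'_apply]

/-- Minimum Monte Carlo: the best of several independent uniform samples approximates a given
point of the cube in the first `n` coordinates. -/
lemma eLpNorm_min_headDist_le [IsProbabilityMeasure P] {ι : Type*} [Fintype ι] [Nonempty ι]
    {Θ : ι → Ω → Fin D → ℝ} (hΘ : ∀ k, Measurable (Θ k)) (hindep : iIndepFun Θ P) {c : ℝ}
    (hc : 0 < c) (hunif : ∀ k, P.map (Θ k) = (volume : Measure (Fin D → ℝ))[|cube D (-c) c])
    {n : ℕ} (hn1 : 1 ≤ n) (hnD : n ≤ D) {ϑ : Fin D → ℝ} (hϑ : ∀ i, |ϑ i| ≤ c) {p : ℝ}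
    (hp : 1 ≤ p) :
    eLpNorm (fun ω => Finset.univ.inf' Finset.univ_nonempty fun k => headDist n ϑ (Θ k ω))
      (ENNReal.ofReal p) P
      ≤ ENNReal.ofReal (2 * c * p / (Fintype.card ι : ℝ) ^ ((n : ℝ)⁻¹)) := by
  set f : Ω → ℝ := fun ω => Finset.univ.inf' Finset.univ_nonempty fun k => headDist n ϑ (Θ k ω)
    with hfdef
  have hf0 : ∀ ω, 0 ≤ f ω := fun ω =>
    (Finset.le_inf'_iff _ _).2 fun k _ => headDist_nonneg _ _ _
  have hg : Measurable (headDist n ϑ) := (continuous_headDist n ϑ).measurable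
  have hf : Measurable f := measurable_min_headDist hΘ n ϑ
  set K := Fintype.card ι with hK
  have hK0 : (0 : ℝ) < K := by exact_mod_cast Fintype.card_pos
  have hn0 : (0 : ℝ) < n := by exact_mod_cast hn1
  have hp0 : 0 < p := by linarith
  have h2c : 0 < 2 * c := by linarith
  -- All samples must miss: independence gives `(1 - (t/2c)^n)^K ≤ exp(-K (t/2c)^n)` for `t ≤ 2c`,
  -- and larger distances have probability zero.
  have htail : ∀ t, 0 < t → P {ω | t < f ω}
      ≤ ENNReal.ofReal (1 * Real.exp (-(K / (2 * c) ^ (n : ℝ)) * t ^ (n : ℝ))) := by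
    intro t ht
    set S := {θ : Fin D → ℝ | headDist n ϑ θ ≤ t}
    have hS : MeasurableSet S := measurableSet_le hg measurable_const
    have hone : ∀ k, P (Θ k ⁻¹' Sᶜ) ≤ ENNReal.ofReal (Real.exp (-(t / (2 * c)) ^ n)) := by
      intro k
      have hpm : IsProbabilityMeasure ((volume : Measure (Fin D → ℝ))[|cube D (-c) c]) := by
        rw [← hunif k]; exact Measure.isProbabilityMeasure_map (hΘ k).aemeasurable
      rw [← Measure.map_apply (hΘ k) hS.compl, hunif k, prob_compl_eq_one_sub hS]
      rcases le_total t (2 * c) with h | h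
      · calc 1 - _ ≤ 1 - ENNReal.ofReal ((t / (2 * c)) ^ n) :=
              tsub_le_tsub_left (uniform_headDist_le hnD hc ht.le h hϑ) _
          _ = ENNReal.ofReal (1 - (t / (2 * c)) ^ n) := by
              rw [ENNReal.ofReal_sub _ (by positivity), ENNReal.ofReal_one]
          _ ≤ _ := ENNReal.ofReal_le_ofReal (Real.one_sub_le_exp_neg _)
      · have h1 := uniform_headDist_le hnD hc h2c.le le_rfl hϑ
        rw [div_self h2c.ne', one_pow, ENNReal.ofReal_one] at h1
        have h2 := h1.trans (measure_mono (t := S) fun θ hθ => le_trans hθ h)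
        rw [tsub_eq_zero_of_le h2]
        exact zero_le
    have hset : {ω | t < f ω} = ⋂ k ∈ (Finset.univ : Finset ι), Θ k ⁻¹' Sᶜ := by
      ext ω
      simp [hfdef, S, Finset.lt_inf'_iff]
    rw [hset, hindep.measure_inter_preimage_eq_mul _ fun k _ => hS.compl]
    calc _ ≤ ∏ _k : ι, ENNReal.ofReal (Real.exp (-(t / (2 * c)) ^ n)) :=
          Finset.prod_le_prod' fun k _ => hone k
      _ = _ := by
          rw [Finset.prod_const, Finset.card_univ, ← ENNReal.ofReal_pow (Real.exp_pos _).le,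
            ← Real.exp_nat_mul, one_mul, Real.rpow_natCast, Real.rpow_natCast]
          congr 2
          rw [div_pow]; ring
  refine eLpNorm_le_of_lintegral_rpow_le hf0 hp0 (by positivity) ?_
  refine (lintegral_rpow_le_of_tail hf0 hf zero_le_one (by positivity) hn0 hp0 htail).trans
    (ENNReal.ofReal_le_ofReal ?_)
  have hG : Real.Gamma (p / n + 1) ≤ p ^ p := by
    have hpn : p / n ≤ p := div_le_self hp0.le (by exact_mod_cast hn1)
    calc _ ≤ (max 1 (p / n)) ^ (p / n) := Gamma_add_one_le_rpow (by positivity)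
      _ ≤ p ^ (p / n) := by
          gcongr
          exact max_le hp hpn
      _ ≤ p ^ p := Real.rpow_le_rpow_of_exponent_le hp hpn
  have hb : (K / (2 * c) ^ (n : ℝ)) ^ (-p / (n : ℝ)) = (2 * c / (K : ℝ) ^ ((n : ℝ)⁻¹)) ^ p := by
    rw [neg_div, Real.rpow_neg (by positivity), ← Real.inv_rpow (by positivity), inv_div,
      Real.div_rpow (by positivity) hK0.le, Real.div_rpow h2c.le (by positivity),
      ← Real.rpow_mul h2c.le, ← Real.rpow_mul hK0.le]
    congr 2 <;> field_simp
  rw [one_mul, hb]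
  calc _ ≤ (2 * c / (K : ℝ) ^ ((n : ℝ)⁻¹)) ^ p * p ^ p := by gcongr
    _ = _ := by
        rw [← Real.mul_rpow (by positivity) hp0.le]
        congr 1; ring

end MonteCarlo

/-! ### Hoeffding moments and maxima over finite families. -/

section Concentration

variable {Ω : Type*} [MeasurableSpace Ω] {P : Measure Ω}

/-- Moment form of Hoeffding's inequality. -/
lemma lintegral_abs_mean_sub_rpow_le [IsProbabilityMeasure P] {ι : Type*} [Fintype ι] [Nonempty ι]
    {V : ι → Ω → ℝ} (hV : ∀ j, Measurable (V j)) (hindep : iIndepFun V P) {Δ m : ℝ} (hΔ : 0 < Δ)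
    (hmem : ∀ j ω, V j ω ∈ Set.Icc 0 Δ) (hm : ∀ j, ∫ ω, V j ω ∂P = m) {q : ℝ} (hq : 2 ≤ q) :
    ∫⁻ ω, ENNReal.ofReal (|1 / (Fintype.card ι : ℝ) * ∑ j, V j ω - m| ^ q) ∂P
      ≤ ENNReal.ofReal ((Δ * √q / √(Fintype.card ι : ℝ)) ^ q) := by
  set M := Fintype.card ι
  have hM0 : (0 : ℝ) < M := by exact_mod_cast Fintype.card_pos
  have hq0 : 0 < q := by linarith
  have hsub : ∀ j, HasSubgaussianMGF (fun ω => V j ω - m) ((‖Δ - 0‖₊ / 2) ^ 2) P := fun j => by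
    rw [← hm j]
    exact hasSubgaussianMGF_of_mem_Icc (hV j).aemeasurable (Filter.Eventually.of_forall (hmem j))
  have hind : iIndepFun (fun j ω => V j ω - m) P :=
    hindep.comp (fun _ x => x - m) fun _ => by fun_prop
  have hsum := HasSubgaussianMGF.sum_of_iIndepFun hind (s := Finset.univ) fun j _ => hsub j
  have hcst : ((∑ _j : ι, ((‖Δ - 0‖₊ / 2) ^ 2) : NNReal) : ℝ) = M * (Δ / 2) ^ 2 := by
    simp [M, abs_of_pos hΔ]
  set Z : Ω → ℝ := fun ω => 1 / (M : ℝ) * ∑ j, V j ω - m with hZ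
  have hZsum : ∀ ω, ∑ j, (V j ω - m) = M * Z ω := fun ω => by
    simp only [hZ, Finset.sum_sub_distrib, Finset.sum_const, Finset.card_univ, nsmul_eq_mul]
    field_simp
    simp [M, mul_comm]
  have hZm : Measurable Z := by fun_prop
  have htail : ∀ t, 0 < t → P {ω | t < |Z ω|}
      ≤ ENNReal.ofReal (2 * Real.exp (-(2 * M / Δ ^ 2) * t ^ (2 : ℝ))) := by
    intro t ht
    have hexp : Real.exp (-(M * t) ^ 2 / (2 * (M * (Δ / 2) ^ 2)))
        = Real.exp (-(2 * M / Δ ^ 2) * t ^ (2 : ℝ)) := by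
      rw [Real.rpow_two]; congr 1; field_simp
    have h1 := hsum.measure_ge_le (ε := M * t) (by positivity)
    have h2 := hsum.neg.measure_ge_le (ε := M * t) (by positivity)
    rw [hcst, hexp] at h1 h2
    rw [measureReal_def, ← ENNReal.le_ofReal_iff_toReal_le (measure_ne_top _ _)
      (Real.exp_pos _).le] at h1 h2
    rw [two_mul, ENNReal.ofReal_add (Real.exp_pos _).le (Real.exp_pos _).le]
    refine le_trans ?_ (add_le_add h1 h2)
    refine (measure_mono fun ω hω => ?_).trans (measure_union_le _ _)
    rcases lt_abs.1 (show t < |Z ω| from hω) with h | h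
    · left
      simp only [Set.mem_ofPred_eq, hZsum]
      exact mul_le_mul_of_nonneg_left h.le hM0.le
    · right
      simp only [Set.mem_ofPred_eq, Pi.neg_apply, hZsum]
      rw [← mul_neg]
      exact mul_le_mul_of_nonneg_left h.le hM0.le
  refine (lintegral_rpow_le_of_tail (fun ω => abs_nonneg _) hZm.abs zero_le_two (by positivity)
    zero_lt_two hq0 htail).trans (ENNReal.ofReal_le_ofReal ?_)
  have hG : Real.Gamma (q / 2 + 1) ≤ (q / 2) ^ (q / 2) := by
    have := Gamma_add_one_le_rpow (q := q / 2) (by positivity)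
    rwa [max_eq_right (by linarith)] at this
  -- Absorbs the factor `2` of the two-sided tail into the `q`-th power; this needs `q ≥ 2` only in
  -- the weaker form `q ≥ 1`.
  have h2q : (2 : ℝ) ≤ 4 ^ (q / 2) := by
    calc (2 : ℝ) ≤ 4 ^ (1 : ℝ) := by norm_num
      _ ≤ 4 ^ (q / 2) := Real.rpow_le_rpow_of_exponent_le (by norm_num) (by linarith)
  calc 2 * (2 * M / Δ ^ 2) ^ (-q / 2) * Real.Gamma (q / 2 + 1)
      ≤ 4 ^ (q / 2) * (2 * M / Δ ^ 2) ^ (-q / 2) * (q / 2) ^ (q / 2) := by gcongr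
    _ = (4 * (Δ ^ 2 / (2 * M)) * (q / 2)) ^ (q / 2) := by
        rw [neg_div, Real.rpow_neg (by positivity), ← Real.inv_rpow (by positivity), inv_div,
          Real.mul_rpow (by positivity) (by positivity), Real.mul_rpow (by positivity) (by positivity)]
    _ = ((Δ * √q / √M) ^ 2) ^ (q / 2) := by
        rw [div_pow, mul_pow, Real.sq_sqrt hq0.le, Real.sq_sqrt hM0.le]
        congr 1; field_simp; norm_num
    _ = _ := by
        rw [← Real.rpow_natCast, ← Real.rpow_mul (by positivity)]
        congr 1; push_cast; ring

/-- The `ℓ^q`-norm of finitely many random variables dominates their maximum. -/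
lemma eLpNorm_finite_sum_rpow_le {σ : Type*} [Fintype σ] {Z : σ → Ω → ℝ}
    (hZm : ∀ s, Measurable (Z s)) {q B : ℝ} (hq : 0 < q) (hB : 0 ≤ B)
    (hZ : ∀ s, ∫⁻ ω, ENNReal.ofReal (|Z s ω| ^ q) ∂P ≤ ENNReal.ofReal (B ^ q)) :
    eLpNorm (fun ω => (∑ s, |Z s ω| ^ q) ^ (1 / q)) (ENNReal.ofReal q) P
      ≤ ENNReal.ofReal ((Fintype.card σ : ℝ) ^ (1 / q) * B) := by
  refine eLpNorm_le_of_lintegral_rpow_le (fun ω => by positivity) hq (by positivity) ?_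
  calc ∫⁻ ω, ENNReal.ofReal (((∑ s, |Z s ω| ^ q) ^ (1 / q)) ^ q) ∂P
      = ∫⁻ ω, ∑ s, ENNReal.ofReal (|Z s ω| ^ q) ∂P := by
        refine lintegral_congr fun ω => ?_
        rw [← Real.rpow_mul (by positivity), one_div_mul_cancel hq.ne', Real.rpow_one,
          ENNReal.ofReal_sum_of_nonneg fun s _ => by positivity]
    _ = ∑ s, ∫⁻ ω, ENNReal.ofReal (|Z s ω| ^ q) ∂P := by
        refine lintegral_finsetSum _ fun s _ => ?_
        have := hZm s
        fun_prop
    _ ≤ ∑ _s : σ, ENNReal.ofReal (B ^ q) := Finset.sum_le_sum fun s _ => hZ s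
    _ = _ := by
        rw [Finset.sum_const, Finset.card_univ, nsmul_eq_mul, Real.mul_rpow (by positivity) hB,
          ← Real.rpow_mul (by positivity), one_div_mul_cancel hq.ne', Real.rpow_one,
          ENNReal.ofReal_mul (by positivity), ENNReal.ofReal_natCast]

lemma abs_le_finite_sum_rpow {σ : Type*} [Fintype σ] (z : σ → ℝ) {q : ℝ} (hq : 0 < q) (s : σ) :
    |z s| ≤ (∑ s, |z s| ^ q) ^ (1 / q) := by
  calc |z s| = (|z s| ^ q) ^ (1 / q) := by
        rw [← Real.rpow_mul (abs_nonneg _), mul_one_div_cancel hq.ne', Real.rpow_one]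
    _ ≤ _ := by
        gcongr
        exact Finset.single_le_sum (f := fun s => |z s| ^ q) (fun s _ => by positivity)
          (Finset.mem_univ s)

end Concentration

/-! ### Risk, empirical risk, and their uniform deviation. -/

section Risk

variable {Ω : Type*} [MeasurableSpace Ω] {P : Measure Ω} [IsProbabilityMeasure P]
  {D d depth : ℕ} {l : ℕ → ℕ} {a b u v : ℝ}

lemma abs_sub_sq_mem {x y : ℝ} (hx : x ∈ Set.Icc u v) (hy : y ∈ Set.Icc u v) :
    |x - y| ^ 2 ∈ Set.Icc 0 ((v - u) ^ 2) := by
  refine ⟨by positivity, ?_⟩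
  have : |x - y| ≤ v - u := abs_le.2 ⟨by linarith [hx.1, hy.2], by linarith [hx.2, hy.1]⟩
  gcongr

lemma abs_sq_sub_sq_le {x y t : ℝ} (hx : x ∈ Set.Icc u v) (hy : y ∈ Set.Icc u v)
    (ht : t ∈ Set.Icc u v) : |(|x - t| ^ 2 - |y - t| ^ 2)| ≤ 2 * (v - u) * |x - y| := by
  rw [sq_abs, sq_abs, show (x - t) ^ 2 - (y - t) ^ 2 = (x + y - 2 * t) * (x - y) by ring, abs_mul]
  refine mul_le_mul_of_nonneg_right ?_ (abs_nonneg _)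
  rw [abs_le]
  constructor <;> linarith [hx.1, hx.2, hy.1, hy.2, ht.1, ht.2]

/-- The risk of the network with parameters `θ`. -/
noncomputable def risk (h0 : l 0 = d) (h1 : l depth = 1) (P : Measure Ω) (X : Ω → cube d a b)
    (Y : Ω → Set.Icc u v) (θ : Fin D → ℝ) : ℝ :=
  ∫ ω, |realNN h0 h1 u v θ (X ω) - (Y ω : ℝ)| ^ 2 ∂P

/-- The empirical risk of the network with parameters `θ`. -/
noncomputable def empRisk {ι : Type*} [Fintype ι] (h0 : l 0 = d) (h1 : l depth = 1)
    (X : ι → Ω → cube d a b) (Y : ι → Ω → Set.Icc u v) (θ : Fin D → ℝ) (ω : Ω) : ℝ :=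
  1 / (Fintype.card ι : ℝ) * ∑ j, |realNN h0 h1 u v θ (X j ω) - (Y j ω : ℝ)| ^ 2

lemma measurable_realNN (h0 : l 0 = d) (h1 : l depth = 1) (θ : Fin D → ℝ) :
    Measurable fun x : cube d a b => realNN h0 h1 u v θ x := by
  have : Continuous fun x : cube d a b => realNN h0 h1 u v θ x :=
    (continuous_realNN h0 h1).comp (continuous_const.prodMk continuous_subtype_val)
  exact this.measurable

lemma measurable_loss (h0 : l 0 = d) (h1 : l depth = 1) (θ : Fin D → ℝ) :
    Measurable fun z : cube d a b × Set.Icc u v =>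
      |realNN h0 h1 u v θ z.1 - (z.2 : ℝ)| ^ 2 :=
  ((((measurable_realNN h0 h1 θ).comp measurable_fst).sub
    (measurable_subtype_coe.comp measurable_snd)).abs).pow_const 2

lemma measurable_loss_comp (h0 : l 0 = d) (h1 : l depth = 1) (θ : Fin D → ℝ)
    {X : Ω → cube d a b} {Y : Ω → Set.Icc u v} (hX : Measurable X) (hY : Measurable Y) :
    Measurable fun ω => |realNN h0 h1 u v θ (X ω) - (Y ω : ℝ)| ^ 2 := by
  have e1 : Measurable fun ω => realNN h0 h1 u v θ (X ω) := (measurable_realNN h0 h1 θ).comp hX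
  have e2 : Measurable fun ω => (Y ω : ℝ) := measurable_subtype_coe.comp hY
  exact (e1.sub e2).abs.pow_const 2

lemma integrable_of_mem_Icc {f : Ω → ℝ} (hf : Measurable f) {s t : ℝ}
    (h : ∀ ω, f ω ∈ Set.Icc s t) : Integrable f P :=
  Integrable.of_mem_Icc s t hf.aemeasurable (Filter.Eventually.of_forall h)

lemma integrable_loss (h0 : l 0 = d) (h1 : l depth = 1) (hdepth : 1 ≤ depth) (huv : u ≤ v)
    {X : Ω → cube d a b} {Y : Ω → Set.Icc u v} (hX : Measurable X) (hY : Measurable Y)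
    (θ : Fin D → ℝ) :
    Integrable (fun ω => |realNN h0 h1 u v θ (X ω) - (Y ω : ℝ)| ^ 2) P :=
  integrable_of_mem_Icc (measurable_loss_comp h0 h1 θ hX hY)
    fun ω => abs_sub_sq_mem (realNN_mem h0 h1 hdepth huv θ _) (Y ω).2

/-- Bias-variance decomposition of the risk. -/
lemma risk_eq_sqError_add (h0 : l 0 = d) (h1 : l depth = 1) (hdepth : 1 ≤ depth) (huv : u ≤ v)
    {X : Ω → cube d a b} {Y : Ω → Set.Icc u v} (hX : Measurable X) (hY : Measurable Y)
    {E : cube d a b → Set.Icc u v} (hEm : Measurable E)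
    (hE : (fun ω => (E (X ω) : ℝ)) =ᵐ[P]
      P[fun ω => (Y ω : ℝ) | MeasurableSpace.comap X inferInstance])
    (θ : Fin D → ℝ) :
    risk h0 h1 P X Y θ
      = sqError h0 h1 E (P.map X) θ + ∫ ω, |(E (X ω) : ℝ) - (Y ω : ℝ)| ^ 2 ∂P := by
  have hgm : Measurable fun x : cube d a b => realNN h0 h1 u v θ x - (E x : ℝ) :=
    (measurable_realNN h0 h1 θ).sub (measurable_subtype_coe.comp hEm)
  have hm : MeasurableSpace.comap X inferInstance ≤ ‹MeasurableSpace Ω› := hX.comap_le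
  set g : Ω → ℝ := fun ω => realNN h0 h1 u v θ (X ω) - (E (X ω) : ℝ) with hg
  have hgsm : StronglyMeasurable[MeasurableSpace.comap X inferInstance] g :=
    (hgm.comp (comap_measurable X)).stronglyMeasurable
  have hYm : Measurable fun ω => (Y ω : ℝ) := measurable_subtype_coe.comp hY
  have hEXm : Measurable fun ω => (E (X ω) : ℝ) := measurable_subtype_coe.comp (hEm.comp hX)
  have hgmΩ : Measurable g := hgm.comp hX
  have hYi : Integrable (fun ω => (Y ω : ℝ)) P := integrable_of_mem_Icc hYm fun ω => (Y ω).2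
  have hgb : ∀ ω, ‖g ω‖ ≤ v - u := fun ω => by
    have h1 := realNN_mem h0 h1 hdepth huv θ (X ω)
    have h2 := (E (X ω)).2
    rw [Real.norm_eq_abs, abs_le]
    constructor <;> simp only [hg] <;> linarith [h1.1, h1.2, h2.1, h2.2]
  have hgY : Integrable (g * fun ω => (Y ω : ℝ)) P :=
    hYi.bdd_mul hgmΩ.aestronglyMeasurable (Filter.Eventually.of_forall hgb)
  have hEi : Integrable (fun ω => (E (X ω) : ℝ)) P :=
    integrable_of_mem_Icc hEXm fun ω => (E (X ω)).2
  have hgE : Integrable (g * fun ω => (E (X ω) : ℝ)) P :=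
    hEi.bdd_mul hgmΩ.aestronglyMeasurable (Filter.Eventually.of_forall hgb)
  -- `g` is a function of `X`, so it can be pulled out of the conditional expectation of `g * Y`:
  -- the residual is orthogonal to it.
  have hcross : ∫ ω, g ω * ((E (X ω) : ℝ) - Y ω) ∂P = 0 := by
    have h1 : ∫ ω, (g * fun ω => (Y ω : ℝ)) ω ∂P = ∫ ω, (g * fun ω => (E (X ω) : ℝ)) ω ∂P := by
      rw [← integral_condExp hm]
      refine integral_congr_ae ?_
      filter_upwards [condExp_mul_of_stronglyMeasurable_left hgsm hgY hYi, hE] with ω h h'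
      rw [h, Pi.mul_apply, Pi.mul_apply, ← h']
    have h2 : ∀ ω, g ω * ((E (X ω) : ℝ) - Y ω)
        = (g * fun ω => (E (X ω) : ℝ)) ω - (g * fun ω => (Y ω : ℝ)) ω := fun ω => by
      simp only [Pi.mul_apply]; ring
    simp only [h2]
    rw [integral_sub hgE hgY, h1, sub_self]
  have hg2 : Integrable (fun ω => |g ω| ^ 2) P :=
    integrable_of_mem_Icc (hgmΩ.abs.pow_const 2) fun ω =>
      abs_sub_sq_mem (realNN_mem h0 h1 hdepth huv θ (X ω)) (E (X ω)).2
  have hE2 : Integrable (fun ω => |(E (X ω) : ℝ) - Y ω| ^ 2) P :=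
    integrable_of_mem_Icc ((hEXm.sub hYm).abs.pow_const 2) fun ω =>
      abs_sub_sq_mem (E (X ω)).2 (Y ω).2
  have hgc : Integrable (fun ω => 2 * (g ω * ((E (X ω) : ℝ) - Y ω))) P :=
    ((hEi.sub hYi).bdd_mul hgmΩ.aestronglyMeasurable (Filter.Eventually.of_forall hgb)).const_mul 2
  have hexp : ∀ ω, |realNN h0 h1 u v θ (X ω) - (Y ω : ℝ)| ^ 2
      = |g ω| ^ 2 + 2 * (g ω * ((E (X ω) : ℝ) - Y ω)) + |(E (X ω) : ℝ) - Y ω| ^ 2 := fun ω => by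
    simp only [hg, sq_abs]; ring
  unfold risk
  simp only [hexp]
  rw [integral_add (f := fun ω => |g ω| ^ 2 + 2 * (g ω * ((E (X ω) : ℝ) - Y ω))) (hg2.add hgc) hE2,
    integral_add hg2 hgc, integral_const_mul, hcross, mul_zero,
    add_zero]
  congr 1
  unfold sqError
  rw [integral_map hX.aemeasurable (hgm.abs.pow_const 2).aestronglyMeasurable]

lemma abs_empRisk_sub_le {Ω' ι : Type*} [Fintype ι] [Nonempty ι] (h0 : l 0 = d) (h1 : l depth = 1)
    (hdepth : 1 ≤ depth) (huv : u ≤ v) {X : ι → Ω' → cube d a b} {Y : ι → Ω' → Set.Icc u v}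
    {θ ϑ : Fin D → ℝ} {ε : ℝ}
    (h : ∀ x : cube d a b, |realNN h0 h1 u v θ x - realNN h0 h1 u v ϑ x| ≤ ε) (ω : Ω') :
    |empRisk h0 h1 X Y θ ω - empRisk h0 h1 X Y ϑ ω| ≤ 2 * (v - u) * ε := by
  have hM0 : (0 : ℝ) < Fintype.card ι := by exact_mod_cast Fintype.card_pos
  unfold empRisk
  rw [← mul_sub, ← Finset.sum_sub_distrib, abs_mul, abs_of_pos (by positivity), one_div,
    inv_mul_le_iff₀ hM0]
  refine (Finset.abs_sum_le_sum_abs _ _).trans ?_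
  refine (Finset.sum_le_card_nsmul _ _ (2 * (v - u) * ε) fun j _ => ?_).trans_eq
    (by rw [nsmul_eq_mul, Finset.card_univ])
  refine (abs_sq_sub_sq_le (realNN_mem h0 h1 hdepth huv θ _) (realNN_mem h0 h1 hdepth huv ϑ _)
    (Y j ω).2).trans ?_
  exact mul_le_mul_of_nonneg_left (h _) (by linarith)

lemma abs_risk_sub_le (h0 : l 0 = d) (h1 : l depth = 1) (hdepth : 1 ≤ depth) (huv : u ≤ v)
    {X : Ω → cube d a b} {Y : Ω → Set.Icc u v} (hX : Measurable X) (hY : Measurable Y)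
    {θ ϑ : Fin D → ℝ} {ε : ℝ}
    (h : ∀ x : cube d a b, |realNN h0 h1 u v θ x - realNN h0 h1 u v ϑ x| ≤ ε) :
    |risk h0 h1 P X Y θ - risk h0 h1 P X Y ϑ| ≤ 2 * (v - u) * ε := by
  unfold risk
  rw [← integral_sub (integrable_loss h0 h1 hdepth huv hX hY θ)
    (integrable_loss h0 h1 hdepth huv hX hY ϑ)]
  have := norm_integral_le_of_norm_le_const (μ := P) (C := 2 * (v - u) * ε)
    (f := fun ω => |realNN h0 h1 u v θ (X ω) - (Y ω : ℝ)| ^ 2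
      - |realNN h0 h1 u v ϑ (X ω) - (Y ω : ℝ)| ^ 2) (Filter.Eventually.of_forall fun ω => by
        refine (abs_sq_sub_sq_le (realNN_mem h0 h1 hdepth huv θ _)
          (realNN_mem h0 h1 hdepth huv ϑ _) (Y ω).2).trans ?_
        exact mul_le_mul_of_nonneg_left (h _) (by linarith))
  simpa using this

/-- The moments of the deviation of the empirical risk from the risk at a single parameter. -/
lemma lintegral_abs_empRisk_sub_risk_rpow_le {ι : Type*} [Fintype ι] [Nonempty ι]
    (h0 : l 0 = d) (h1 : l depth = 1) (hdepth : 1 ≤ depth) (huv : u < v)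
    {X : ι → Ω → cube d a b} {Y : ι → Ω → Set.Icc u v} (hX : ∀ j, Measurable (X j))
    (hY : ∀ j, Measurable (Y j)) (hindep : iIndepFun (fun j ω => (X j ω, Y j ω)) P)
    {X₀ : Ω → cube d a b} {Y₀ : Ω → Set.Icc u v}
    (hident : ∀ j, IdentDistrib (fun ω => (X j ω, Y j ω)) (fun ω => (X₀ ω, Y₀ ω)) P P)
    (θ : Fin D → ℝ) {q : ℝ} (hq : 2 ≤ q) :
    ∫⁻ ω, ENNReal.ofReal (|empRisk h0 h1 X Y θ ω - risk h0 h1 P X₀ Y₀ θ| ^ q) ∂P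
      ≤ ENNReal.ofReal (((v - u) ^ 2 * √q / √(Fintype.card ι : ℝ)) ^ q) := by
  refine lintegral_abs_mean_sub_rpow_le
    (V := fun j ω => |realNN h0 h1 u v θ (X j ω) - (Y j ω : ℝ)| ^ 2)
    (fun j => measurable_loss_comp h0 h1 θ (hX j) (hY j))
    (hindep.comp (fun _ z => |realNN h0 h1 u v θ z.1 - (z.2 : ℝ)| ^ 2)
      fun _ => measurable_loss h0 h1 θ) (by have := sub_pos.2 huv; positivity)
    (fun j ω => abs_sub_sq_mem (realNN_mem h0 h1 hdepth huv.le θ _) (Y j ω).2)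
    (fun j => ((hident j).comp (measurable_loss h0 h1 θ)).integral_eq) hq

/-- The logarithm of the number of net points per coordinate. Its summands are absorbed by `log x ≤
x - 1` and by `log (3MBc) ≥ 1`, which holds because `3 > e`. -/
lemma log_covering_le {depth w : ℕ} {M B c : ℝ} (hdepth : 1 ≤ depth) (hw : 1 ≤ w) (hM : 1 ≤ M)
    (hc : 1 ≤ c) (hB : 1 ≤ B) :
    Real.log (8 * depth * c * ((w : ℝ) + 1) ^ depth * B ^ depth * √M)
      ≤ 3 * depth * (w + 1) * Real.log (3 * M * B * c) := by
  have hd : (1 : ℝ) ≤ depth := by exact_mod_cast hdepth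
  have hw' : (1 : ℝ) ≤ w := by exact_mod_cast hw
  have hlog3 : 1 ≤ Real.log 3 := by
    rw [Real.le_log_iff_exp_le (by norm_num)]
    linarith [Real.exp_one_lt_d9]
  have hΛ : Real.log (3 * M * B * c) = Real.log 3 + Real.log M + Real.log B + Real.log c := by
    rw [Real.log_mul (by positivity) (by positivity), Real.log_mul (by positivity) (by positivity),
      Real.log_mul (by positivity) (by positivity)]
  have hlM := Real.log_nonneg hM
  have hlB := Real.log_nonneg hB
  have hlc := Real.log_nonneg hc
  have e : Real.log (8 * depth * c * ((w : ℝ) + 1) ^ depth * B ^ depth * √M)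
      = Real.log 8 + Real.log depth + Real.log c + depth * Real.log (w + 1) + depth * Real.log B
        + Real.log M / 2 := by
    rw [Real.log_mul (by positivity) (by positivity), Real.log_mul (by positivity) (by positivity),
      Real.log_mul (by positivity) (by positivity), Real.log_mul (by positivity) (by positivity),
      Real.log_mul (by positivity) (by positivity), Real.log_pow, Real.log_pow,
      Real.log_sqrt (by linarith)]
  have h8 : Real.log 8 ≤ 3 := by
    rw [show (8 : ℝ) = 2 ^ 3 by norm_num, Real.log_pow]
    push_cast
    linarith [Real.log_two_lt_d9]
  have hld : Real.log depth ≤ depth := (Real.log_le_sub_one_of_pos (by linarith)).trans (by linarith)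
  have hlw : Real.log ((w : ℝ) + 1) ≤ w :=
    (Real.log_le_sub_one_of_pos (by linarith)).trans (by linarith)
  rw [e, hΛ]
  set x := Real.log M
  set y := Real.log B
  set z := Real.log c
  set Λ := Real.log 3 + x + y + z
  have hΛ1 : 1 ≤ Λ := by simp only [Λ]; linarith
  have h1 : (depth : ℝ) * Real.log (w + 1) ≤ depth * w := by gcongr
  have h2 : z + depth * y + x / 2 ≤ depth * Λ := by
    have h3 : (depth : ℝ) * (y + (z + x)) ≤ depth * Λ := by
      gcongr; simp only [Λ]; linarith
    have h4 : 1 * (z + x) ≤ (depth : ℝ) * (z + x) := by gcongr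
    linarith
  have h5 : (depth : ℝ) * 1 ≤ depth * Λ := by gcongr
  have h6 : (depth : ℝ) * w * 1 ≤ depth * w * Λ := by gcongr
  have h7 : (depth : ℝ) * Λ * 1 ≤ depth * Λ * w := by gcongr
  nlinarith

/-- The left side is the logarithm of the size of the net. A square on the right is wanted because
the moment order `q` enters the deviation as `√q`. -/
lemma log_net_card_le {depth w np n : ℕ} {M B c m : ℝ} (hdepth : 1 ≤ depth) (hw : 1 ≤ w)
    (hnp : np ≤ depth * (w * (w + 1))) (hM : 1 ≤ M) (hc : 1 ≤ c) (hB : 1 ≤ B) (hn : 1 ≤ n)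
    (hnH : (n : ℝ) ≤ 2 * (4 * depth * c * ((w : ℝ) + 1) ^ depth * B ^ depth * √M)) (hm : 1 ≤ m)
    (hlm : Real.log (3 * M * B * c) ≤ m) :
    np * Real.log n ≤ 2 * (depth * ((w : ℝ) + 1) ^ 2 * m) ^ 2 := by
  have hn' : (1 : ℝ) ≤ n := by exact_mod_cast hn
  have hw' : (1 : ℝ) ≤ w := by exact_mod_cast hw
  have e1 : Real.log n ≤ 3 * depth * (w + 1) * m := by
    calc Real.log n
        ≤ Real.log (8 * depth * c * ((w : ℝ) + 1) ^ depth * B ^ depth * √M) :=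
          Real.log_le_log (by linarith) (hnH.trans_eq (by ring))
      _ ≤ 3 * depth * (w + 1) * Real.log (3 * M * B * c) := log_covering_le hdepth hw hM hc hB
      _ ≤ _ := by gcongr
  have e2 : (np : ℝ) ≤ depth * (w * (w + 1)) := by exact_mod_cast hnp
  have e3 : m ≤ m ^ 2 := le_self_pow₀ hm two_ne_zero
  have e4 : (3 : ℝ) * w ≤ 2 * (w + 1) ^ 2 := by nlinarith
  calc np * Real.log n ≤ (depth * (w * (w + 1))) * (3 * depth * (w + 1) * m) :=
        mul_le_mul e2 e1 (Real.log_nonneg hn') (by positivity)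
    _ = depth ^ 2 * (w + 1) ^ 2 * (3 * w * m) := by ring
    _ ≤ depth ^ 2 * (w + 1) ^ 2 * (2 * (w + 1) ^ 2 * m ^ 2) := by
        refine mul_le_mul_of_nonneg_left ?_ (by positivity)
        exact mul_le_mul e4 e3 (by linarith) (by positivity)
    _ = _ := by ring

/-- A finite net of the first `k` coordinates of the cube `[-B, B]^D`. -/
lemma exists_parameter_net (D k : ℕ) {n : ℕ} (hn : 1 ≤ n) {B : ℝ} (hB : 0 < B) :
    ∃ par : (Fin k → Fin n) → Fin D → ℝ, (∀ σ i, |par σ i| ≤ B) ∧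
      ∀ θ : Fin D → ℝ, (∀ i, |θ i| ≤ B) → ∃ σ, ∀ i < k, |param θ i - param (par σ) i| ≤ B / n := by
  have hBB : -B < B := by linarith
  refine ⟨fun σ i => if h : (i : ℕ) < k then gridPt (-B) B n (σ ⟨i, h⟩) else 0,
    fun σ i => ?_, fun θ hθ => ?_⟩
  · dsimp only
    split_ifs
    · exact abs_le.2 (gridPt_mem hBB.le (Fin.is_lt _))
    · simpa using hB.le
  · choose t ht using fun i : Fin k =>
      exists_gridPt_near hBB (abs_le.1 (abs_param_le hB.le hθ (i : ℕ))) hn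
    refine ⟨t, fun i hi => ?_⟩
    have hti := ht ⟨i, hi⟩
    rw [sub_neg_eq_add, ← two_mul, mul_div_mul_left _ _ two_ne_zero] at hti
    by_cases hiD : i < D
    · simpa [param, hiD, hi] using hti
    · simp only [param, hiD, dif_neg, not_false_eq_true, sub_self, abs_zero]
      positivity

/-- Deviation of the empirical risk from the risk for finitely many parameters. -/
lemma exists_finite_deviation {ι : Type*} [Fintype ι] [Nonempty ι]
    (h0 : l 0 = d) (h1 : l depth = 1) (hdepth : 1 ≤ depth) (huv : u < v)
    {X : ι → Ω → cube d a b} {Y : ι → Ω → Set.Icc u v} (hX : ∀ j, Measurable (X j))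
    (hY : ∀ j, Measurable (Y j)) (hindep : iIndepFun (fun j ω => (X j ω, Y j ω)) P)
    {X₀ : Ω → cube d a b} {Y₀ : Ω → Set.Icc u v}
    (hident : ∀ j, IdentDistrib (fun ω => (X j ω, Y j ω)) (fun ω => (X₀ ω, Y₀ ω)) P P)
    {σ : Type*} [Fintype σ] (par : σ → Fin D → ℝ) {p q : ℝ} (hpq : p ≤ q) (hq : 2 ≤ q)
    (hcard : (Fintype.card σ : ℝ) ≤ Real.exp q) :
    ∃ S : Ω → ℝ, Measurable S ∧
      (∀ s ω, |empRisk h0 h1 X Y (par s) ω - risk h0 h1 P X₀ Y₀ (par s)| ≤ S ω) ∧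
      eLpNorm S (ENNReal.ofReal p) P
        ≤ ENNReal.ofReal (Real.exp 1 * ((v - u) ^ 2 * √q / √(Fintype.card ι : ℝ))) := by
  have hq0 : 0 < q := by linarith
  set Z : σ → Ω → ℝ := fun s ω =>
    empRisk h0 h1 X Y (par s) ω - risk h0 h1 P X₀ Y₀ (par s)
  have hZm : ∀ s, Measurable (Z s) := fun s => by
    refine Measurable.sub_const ?_ _
    refine Measurable.const_mul (Finset.measurable_sum _ fun j _ => ?_) _
    exact measurable_loss_comp h0 h1 (par s) (hX j) (hY j)
  have hSm : Measurable fun ω => (∑ s, |Z s ω| ^ q) ^ (1 / q) := by fun_prop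
  refine ⟨_, hSm, fun s ω => abs_le_finite_sum_rpow (fun s => Z s ω) hq0 s, ?_⟩
  refine (eLpNorm_le_eLpNorm_of_exponent_le (ENNReal.ofReal_le_ofReal hpq)
    hSm.aestronglyMeasurable).trans ?_
  refine (eLpNorm_finite_sum_rpow_le (P := P) hZm hq0 (by positivity)
    (fun s => lintegral_abs_empRisk_sub_risk_rpow_le h0 h1 hdepth huv hX hY hindep hident
      (par s) hq)).trans (ENNReal.ofReal_le_ofReal ?_)
  refine mul_le_mul_of_nonneg_right ?_ (by positivity)
  -- With `q` at least the logarithm of the cardinality, the union over the family costs only `e`.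
  calc (Fintype.card σ : ℝ) ^ (1 / q) ≤ (Real.exp q) ^ (1 / q) := by gcongr
    _ = Real.exp 1 := by rw [← Real.exp_mul, mul_one_div_cancel hq0.ne']

/-- Rounding `e` to `3` and `√2` to `2` yields `6 + 1 ≤ 9`; the linear term uses `t ≤ max 1 (t ^
2)`. -/
lemma deviation_const_le {t x : ℝ} (ht : 0 < t) (hx : 1 ≤ x) (M : ℝ) :
    Real.exp 1 * (t ^ 2 * √(2 * x ^ 2) / √M) + t / √M ≤ 9 * (max 1 (t ^ 2) * x) / √M := by
  obtain ⟨Q, hQ⟩ : ∃ Q, Q = max 1 (t ^ 2) := ⟨_, rfl⟩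
  rw [← hQ]
  have hQ1 : 1 ≤ Q := hQ ▸ le_max_left _ _
  have hQ2 : t ^ 2 ≤ Q := hQ ▸ le_max_right _ _
  have hQ3 : t ≤ Q := by nlinarith [sq_nonneg (t - 1)]
  have hsq : √(2 * x ^ 2) ≤ 2 * x := by
    rw [Real.sqrt_le_left (by positivity)]
    nlinarith
  have he : Real.exp 1 ≤ 3 := by linarith [Real.exp_one_lt_d9]
  rw [← mul_div_assoc, ← add_div]
  refine div_le_div_of_nonneg_right ?_ (Real.sqrt_nonneg M)
  have h1 : t ^ 2 * √(2 * x ^ 2) ≤ Q * (2 * x) :=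
    mul_le_mul hQ2 hsq (Real.sqrt_nonneg _) (by linarith)
  have h2 : Real.exp 1 * (t ^ 2 * √(2 * x ^ 2)) ≤ 3 * (Q * (2 * x)) :=
    mul_le_mul he h1 (by positivity) (by norm_num)
  have h3 : Q * 1 ≤ Q * x := mul_le_mul_of_nonneg_left hx (by linarith)
  linarith

/-- Uniform bound for the deviation of the empirical risk from the risk. -/
theorem exists_uniform_deviation {ι : Type*} [Fintype ι] [Nonempty ι]
    (h0 : l 0 = d) (h1 : l depth = 1) (hdepth : 1 ≤ depth) (huv : u < v)
    {X : ι → Ω → cube d a b} {Y : ι → Ω → Set.Icc u v} (hX : ∀ j, Measurable (X j))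
    (hY : ∀ j, Measurable (Y j)) (hindep : iIndepFun (fun j ω => (X j ω, Y j ω)) P)
    {X₀ : Ω → cube d a b} {Y₀ : Ω → Set.Icc u v} (hX₀ : Measurable X₀) (hY₀ : Measurable Y₀)
    (hident : ∀ j, IdentDistrib (fun ω => (X j ω, Y j ω)) (fun ω => (X₀ ω, Y₀ ω)) P P)
    {c B p : ℝ} (hc : 1 ≤ c) (hcB : c ≤ B) (ha : |a| ≤ c) (hb : |b| ≤ c) (hp : 1 ≤ p) :
    ∃ G : Ω → ℝ, Measurable G ∧
      (∀ θ : Fin D → ℝ, (∀ i, |θ i| ≤ B) → ∀ ω,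
        |empRisk h0 h1 X Y θ ω - risk h0 h1 P X₀ Y₀ θ| ≤ G ω) ∧
      eLpNorm G (ENNReal.ofReal p) P ≤ ENNReal.ofReal (9 * max 1 ((v - u) ^ 2) * depth *
        ((maxWidth depth l : ℝ) + 1) ^ 2 * max p (Real.log (3 * Fintype.card ι * B * c))
          / √(Fintype.card ι : ℝ)) := by
  obtain ⟨M, hMdef⟩ : ∃ M : ℝ, M = (Fintype.card ι : ℝ) := ⟨_, rfl⟩
  rw [← hMdef]
  have hM1 : 1 ≤ M := by rw [hMdef]; exact_mod_cast Fintype.card_pos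
  have hM0 : 0 < M := by linarith
  have hB1 : 1 ≤ B := hc.trans hcB
  have hvu : 0 < v - u := sub_pos.2 huv
  have hdepth' : (1 : ℝ) ≤ depth := by exact_mod_cast hdepth
  obtain ⟨w, hw⟩ : ∃ w, w = maxWidth depth l := ⟨_, rfl⟩
  have hw1 : 1 ≤ w := by rw [hw, ← h1]; exact le_maxWidth l le_rfl
  have hw1' : (1 : ℝ) ≤ w := by exact_mod_cast hw1
  -- Chosen so that with at least `H` points per coordinate, passing to the net moves the network by
  -- at most `1 / (4√M)`, hence each of the two risks by at most `δ / 2` for the `δ` below.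
  obtain ⟨H, hH⟩ : ∃ H : ℝ, H = 4 * depth * c * ((w : ℝ) + 1) ^ depth * B ^ depth * √M :=
    ⟨_, rfl⟩
  have hsM : 1 ≤ √M := Real.one_le_sqrt.2 hM1
  have hH1 : 1 ≤ H := by
    have e1 : (1 : ℝ) ≤ 4 * depth := by linarith
    have e2 : (1 : ℝ) ≤ ((w : ℝ) + 1) ^ depth := one_le_pow₀ (by linarith)
    have e3 : (1 : ℝ) ≤ B ^ depth := one_le_pow₀ hB1
    have e4 := one_le_mul_of_one_le_of_one_le e1 hc
    have e5 := one_le_mul_of_one_le_of_one_le e4 e2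
    have e6 := one_le_mul_of_one_le_of_one_le e5 e3
    rw [hH]
    exact one_le_mul_of_one_le_of_one_le e6 hsM
  obtain ⟨n, hnH, hn2H⟩ : ∃ n : ℕ, H ≤ n ∧ (n : ℝ) ≤ 2 * H :=
    ⟨⌈H⌉₊, Nat.le_ceil H, by linarith [Nat.ceil_lt_add_one (by linarith : 0 ≤ H)]⟩
  have hn1' : (1 : ℝ) ≤ n := hH1.trans hnH
  have hn1 : 1 ≤ n := by exact_mod_cast hn1'
  obtain ⟨m, hm⟩ : ∃ m, m = max p (Real.log (3 * M * B * c)) := ⟨_, rfl⟩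
  have hpm : p ≤ m := by rw [hm]; exact le_max_left _ _
  have hm1 : 1 ≤ m := hp.trans hpm
  obtain ⟨x, hx⟩ : ∃ x : ℝ, x = depth * ((w : ℝ) + 1) ^ 2 * m := ⟨_, rfl⟩
  have hlogn : numParams l depth * Real.log n ≤ 2 * x ^ 2 := by
    rw [hx]
    have hlm : Real.log (3 * M * B * c) ≤ m := by rw [hm]; exact le_max_right _ _
    have hnp : numParams l depth ≤ depth * (w * (w + 1)) := by rw [hw]; exact numParams_le l depth
    rw [hH] at hn2H
    exact log_net_card_le hdepth hw1 hnp hM1 hc hB1 hn1 hn2H hm1 hlm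
  have hmx : m ≤ x := by
    have : (1 : ℝ) ≤ depth * ((w : ℝ) + 1) ^ 2 :=
      one_le_mul_of_one_le_of_one_le hdepth' (one_le_pow₀ (by linarith))
    rw [hx]
    exact le_mul_of_one_le_left (by linarith) this
  have hx1 : 1 ≤ x := hm1.trans hmx
  obtain ⟨par, hparB, hnet⟩ := exists_parameter_net D (numParams l depth) hn1
    (show 0 < B by linarith)
  -- The order `2x²` exceeds both `p` and the logarithm of the size of the net.
  obtain ⟨S, hSm, hSdev, hSnorm⟩ := exists_finite_deviation h0 h1 hdepth huv hX hY hindep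
    hident par (p := p) (q := 2 * x ^ 2) (by nlinarith) (by nlinarith) (by
      rw [Fintype.card_pi_const, Fintype.card_fin, Nat.cast_pow,
        ← Real.log_le_iff_le_exp (by positivity), Real.log_pow]
      exact hlogn)
  rw [← hMdef] at hSnorm
  obtain ⟨δ, hδ⟩ : ∃ δ, δ = (v - u) / √M := ⟨_, rfl⟩
  have hδ0 : 0 ≤ δ := by rw [hδ]; positivity
  refine ⟨fun ω => S ω + δ, hSm.add_const δ, fun θ hθ ω => ?_, ?_⟩
  · obtain ⟨t, ht⟩ := hnet θ hθ
    have hε : depth * c * ((maxWidth depth l : ℝ) + 1) ^ depth * B ^ (depth - 1) * (B / n)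
        ≤ 1 / (4 * √M) := by
      have hpow : B ^ (depth - 1) * B = B ^ depth := by
        rw [← pow_succ, Nat.sub_add_cancel hdepth]
      have : depth * c * ((w : ℝ) + 1) ^ depth * B ^ (depth - 1) * (B / n) = H / (4 * √M) / n := by
        rw [hH, ← hpow]; field_simp
      rw [← hw, this, div_div, div_le_div_iff₀ (by positivity) (by positivity), one_mul, mul_comm]
      exact mul_le_mul_of_nonneg_left hnH (by positivity)
    have hnear : ∀ y : cube d a b, |realNN h0 h1 u v θ y - realNN h0 h1 u v (par t) y|
        ≤ 1 / (4 * √M) := fun y =>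
      (realNN_sub_abs_le h0 h1 hB1 hc (fun i _ => abs_param_le (by linarith) hθ i)
        (fun i _ => abs_param_le (by linarith) (hparB t) i) ht (by positivity)
        (abs_le_of_mem_cube ha hb y)).trans hε
    have b1 := abs_empRisk_sub_le (X := X) (Y := Y) h0 h1 hdepth huv.le hnear ω
    have b2 := abs_risk_sub_le (P := P) h0 h1 hdepth huv.le hX₀ hY₀ hnear
    have b3 := hSdev t ω
    have e : 2 * (v - u) * (1 / (4 * √M)) = δ / 2 := by
      rw [hδ]; field_simp; norm_num
    rw [e] at b1 b2
    rw [abs_le] at b1 b2 b3 ⊢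
    constructor <;> linarith [b1.1, b1.2, b2.1, b2.2, b3.1, b3.2]
  · have hp0 : (1 : ENNReal) ≤ ENNReal.ofReal p := by
      rw [← ENNReal.ofReal_one]; exact ENNReal.ofReal_le_ofReal hp
    have g2 : eLpNorm (fun _ : Ω => δ) (ENNReal.ofReal p) P = ENNReal.ofReal δ := by
      rw [eLpNorm_const _ (zero_lt_one.trans_le hp0).ne' (NeZero.ne P)]
      simp [Real.enorm_of_nonneg hδ0]
    refine (eLpNorm_add_le hSm.aestronglyMeasurable aestronglyMeasurable_const hp0).trans ?_
    rw [g2]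
    refine (add_le_add_left hSnorm _).trans ?_
    rw [← ENNReal.ofReal_add (by positivity) hδ0]
    refine ENNReal.ofReal_le_ofReal ?_
    rw [← hw, ← hm, hδ]
    exact (deviation_const_le hvu hx1 M).trans_eq (by rw [hx]; ring)

end Risk

/-! ### Measurability of the error, norm inequalities, and the second bound. -/

section Total

variable {Ω : Type*} [MeasurableSpace Ω] {P : Measure Ω}
  {D d depth : ℕ} {l : ℕ → ℕ} {a b u v : ℝ}

/-- Source of the measurability of `E`, which the theorem does not assume. -/
lemma continuous_of_lipschitz_l1 {L : ℝ} (hL : 0 ≤ L) {E : cube d a b → Set.Icc u v}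
    (hLip : ∀ x y : cube d a b,
      |(E x : ℝ) - (E y : ℝ)| ≤ L * ∑ i : Fin d, |(x : Fin d → ℝ) i - (y : Fin d → ℝ) i|) :
    Continuous E := by
  refine (LipschitzWith.of_dist_le_mul (K := (L * d).toNNReal) fun x y => ?_).continuous
  refine (hLip x y).trans ?_
  rw [Real.coe_toNNReal _ (by positivity), mul_assoc]
  refine mul_le_mul_of_nonneg_left ?_ hL
  refine (Finset.sum_le_card_nsmul _ _ (dist x y) fun i _ => ?_).trans (by simp)
  exact dist_le_pi_dist (x : Fin d → ℝ) y i

lemma measurable_sqError (h0 : l 0 = d) (h1 : l depth = 1) {E : cube d a b → Set.Icc u v}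
    (hE : Continuous E) (μ : Measure (cube d a b)) [SFinite μ] :
    Measurable (sqError (D := D) h0 h1 E μ) := by
  have hcont : Continuous fun z : (Fin D → ℝ) × cube d a b =>
      |realNN h0 h1 u v z.1 z.2 - (E z.2 : ℝ)| ^ 2 := by
    have e1 : Continuous fun z : (Fin D → ℝ) × cube d a b => realNN h0 h1 u v z.1 z.2 :=
      (continuous_realNN h0 h1).comp
        (continuous_fst.prodMk (continuous_subtype_val.comp continuous_snd))
    have e2 : Continuous fun z : (Fin D → ℝ) × cube d a b => (E z.2 : ℝ) :=
      continuous_subtype_val.comp (hE.comp continuous_snd)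
    exact ((e1.sub e2).abs).pow 2
  exact (StronglyMeasurable.integral_prod_right (ν := μ)
    (f := fun θ x => |realNN h0 h1 u v θ x - (E x : ℝ)| ^ 2) hcont.stronglyMeasurable).measurable

lemma integrable_sq_sub (h0 : l 0 = d) (h1 : l depth = 1) (hdepth : 1 ≤ depth) (huv : u ≤ v)
    {E : cube d a b → Set.Icc u v} (hE : Measurable E) (μ : Measure (cube d a b))
    [IsProbabilityMeasure μ] (θ : Fin D → ℝ) :
    Integrable (fun x : cube d a b => |realNN h0 h1 u v θ x - (E x : ℝ)| ^ 2) μ :=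
  integrable_of_mem_Icc
    (((measurable_realNN h0 h1 θ).sub (measurable_subtype_coe.comp hE)).abs.pow_const 2)
    fun x => abs_sub_sq_mem (realNN_mem h0 h1 hdepth huv θ _) (E x).2

lemma sqError_nonneg (h0 : l 0 = d) (h1 : l depth = 1) (E : cube d a b → Set.Icc u v)
    (μ : Measure (cube d a b)) (θ : Fin D → ℝ) : 0 ≤ sqError h0 h1 E μ θ :=
  integral_nonneg fun _ => by positivity

lemma sqError_le (h0 : l 0 = d) (h1 : l depth = 1) (hdepth : 1 ≤ depth) (huv : u ≤ v)
    {E : cube d a b → Set.Icc u v} (hE : Measurable E) (μ : Measure (cube d a b))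
    [IsProbabilityMeasure μ] {θ : Fin D → ℝ} {ε : ℝ}
    (h : ∀ x : cube d a b, |realNN h0 h1 u v θ x - (E x : ℝ)| ^ 2 ≤ ε) :
    sqError h0 h1 E μ θ ≤ ε := by
  refine (integral_mono (integrable_sq_sub h0 h1 hdepth huv hE μ θ) (integrable_const ε) h).trans ?_
  simp

lemma eLpNorm_le_of_ae_le_affine [IsProbabilityMeasure P] {g G f : Ω → ℝ} (hg0 : ∀ ω, 0 ≤ g ω)
    (hGm : Measurable G) (hfm : AEStronglyMeasurable f P) {e C γ φ p : ℝ} (he : 0 ≤ e) (hC : 0 ≤ C)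
    (hγ : 0 ≤ γ) (hφ : 0 ≤ φ) (hp : 1 ≤ p) (h : ∀ᵐ ω ∂P, g ω ≤ e + 2 * G ω + C * f ω)
    (hG : eLpNorm G (ENNReal.ofReal p) P ≤ ENNReal.ofReal γ)
    (hf : eLpNorm f (ENNReal.ofReal p) P ≤ ENNReal.ofReal φ) :
    eLpNorm g (ENNReal.ofReal p) P ≤ ENNReal.ofReal (e + 2 * γ + C * φ) := by
  have hp1 : (1 : ENNReal) ≤ ENNReal.ofReal p := by
    rw [← ENNReal.ofReal_one]; exact ENNReal.ofReal_le_ofReal hp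
  have hconst : eLpNorm (fun _ : Ω => e) (ENNReal.ofReal p) P = ENNReal.ofReal e := by
    rw [eLpNorm_const _ (zero_lt_one.trans_le hp1).ne' (NeZero.ne P)]
    simp [Real.enorm_of_nonneg he]
  have hG2 : eLpNorm ((2 : ℝ) • G) (ENNReal.ofReal p) P ≤ ENNReal.ofReal (2 * γ) := by
    rw [eLpNorm_const_smul, ENNReal.ofReal_mul zero_le_two, Real.enorm_of_nonneg zero_le_two]
    gcongr
  have hfC : eLpNorm (C • f) (ENNReal.ofReal p) P ≤ ENNReal.ofReal (C * φ) := by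
    rw [eLpNorm_const_smul, ENNReal.ofReal_mul hC, Real.enorm_of_nonneg hC]
    gcongr
  have hm1 : AEStronglyMeasurable ((2 : ℝ) • G) P := hGm.aestronglyMeasurable.const_smul 2
  have hm2 : AEStronglyMeasurable (C • f) P := hfm.const_smul C
  have hm0 : AEStronglyMeasurable (fun _ : Ω => e) P := aestronglyMeasurable_const
  calc eLpNorm g (ENNReal.ofReal p) P
      ≤ eLpNorm ((fun _ : Ω => e) + (2 : ℝ) • G + C • f) (ENNReal.ofReal p) P := by
        refine eLpNorm_mono_ae ?_
        filter_upwards [h] with ω hω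
        rw [Real.norm_of_nonneg (hg0 ω)]
        exact hω.trans (le_abs_self _)
    _ ≤ eLpNorm ((fun _ : Ω => e) + (2 : ℝ) • G) (ENNReal.ofReal p) P
          + eLpNorm (C • f) (ENNReal.ofReal p) P := eLpNorm_add_le (hm0.add hm1) hm2 hp1
    _ ≤ (ENNReal.ofReal e + ENNReal.ofReal (2 * γ)) + ENNReal.ofReal (C * φ) := by
        refine add_le_add ((eLpNorm_add_le hm0 hm1 hp1).trans (add_le_add hconst.le hG2)) hfC
    _ = _ := by
        rw [← ENNReal.ofReal_add he (by positivity), ← ENNReal.ofReal_add (by positivity)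
          (by positivity)]

lemma integral_rpow_le_of_eLpNorm_le {f : Ω → ℝ} (hf0 : ∀ ω, 0 ≤ f ω) (hf : Measurable f)
    {p r : ℝ} (hp : 0 < p) (hr : 0 ≤ r)
    (h : eLpNorm f (ENNReal.ofReal p) P ≤ ENNReal.ofReal r) :
    (∫ ω, f ω ^ p ∂P) ^ (1 / p) ≤ r := by
  rw [eLpNorm_eq_lintegral_rpow_enorm_toReal (by simpa using hp) ENNReal.ofReal_ne_top,
    ENNReal.toReal_ofReal hp.le] at h
  have e : ∫ ω, f ω ^ p ∂P = (∫⁻ ω, ‖f ω‖ₑ ^ p ∂P).toReal := by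
    rw [integral_eq_lintegral_of_nonneg_ae
      (Filter.Eventually.of_forall fun ω => Real.rpow_nonneg (hf0 ω) p)
      (hf.pow_const p).aestronglyMeasurable]
    congr 1
    refine lintegral_congr fun ω => ?_
    rw [Real.enorm_of_nonneg (hf0 ω), ENNReal.ofReal_rpow_of_nonneg (hf0 ω) hp.le]
  rw [e, ENNReal.toReal_rpow]
  exact ENNReal.toReal_le_of_le_ofReal hr h

lemma log_bound_le {M B c p : ℝ} (hM : 1 ≤ M) (hc : 1 ≤ c) (hcB : c ≤ B) :
    18 * max p (Real.log (3 * M * B * c)) ≤ 23 * B * max p (Real.log (Real.exp 1 * M)) := by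
  have hB : 1 ≤ B := hc.trans hcB
  have hlogM := Real.log_nonneg hM
  have hlogeM : Real.log (Real.exp 1 * M) = 1 + Real.log M := by
    rw [Real.log_mul (Real.exp_pos 1).ne' (by positivity), Real.log_exp]
  rw [hlogeM]
  set y := max p (1 + Real.log M)
  have hy : 1 + Real.log M ≤ y := le_max_right _ _
  have hpy : p ≤ y := le_max_left _ _
  rw [← le_div_iff₀' (by norm_num)]
  refine max_le ?_ ?_
  · rw [le_div_iff₀ (by norm_num)]
    nlinarith
  · have h1 : Real.log (3 * M * B * c) ≤ Real.log 3 + Real.log M + 2 * Real.log B := by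
      rw [Real.log_mul (by positivity) (by positivity), Real.log_mul (by positivity) (by positivity),
        Real.log_mul (by positivity) (by positivity)]
      linarith [Real.log_le_log (by linarith) hcB]
    -- The tangent to the logarithm with slope `23/36`, so that `18 * 2 * log B` costs exactly `23 *
    -- B`. The leftover constant is controlled by `3 (36/23)² ≤ e²`, which holds narrowly.
    have h2 : Real.log B ≤ 23 / 36 * B - 1 + Real.log (36 / 23) := by
      have := Real.log_le_sub_one_of_pos (x := 23 / 36 * B) (by positivity)
      have e : Real.log B = Real.log (23 / 36 * B) + Real.log (36 / 23) := by
        rw [← Real.log_mul (by positivity) (by norm_num)]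
        congr 1; ring
      linarith
    have h3 : Real.log 3 + 2 * Real.log (36 / 23) ≤ 2 := by
      have e : Real.log 3 + 2 * Real.log (36 / 23) = Real.log (3 * (36 / 23) ^ 2) := by
        rw [Real.log_mul (by norm_num) (by norm_num), Real.log_pow]; norm_num
      rw [e, Real.log_le_iff_le_exp (by norm_num), show (2 : ℝ) = 1 + 1 by norm_num, Real.exp_add]
      nlinarith [Real.exp_one_gt_d9]
    have h4 : (1 + Real.log M) * B ≤ y * B := mul_le_mul_of_nonneg_right hy (by linarith)
    have h5 : Real.log M * 1 ≤ Real.log M * B := mul_le_mul_of_nonneg_left hB hlogM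
    linarith

lemma total_bound_le {d depth w : ℕ} {A L a b u v c B p M K s : ℝ} (hA : 0 < A) (hL : 0 ≤ L)
    (hLc : L ≤ c) (hab : a < b) (huv : u < v) (hc : 1 ≤ c) (hcB : c ≤ B) (ha : |a| ≤ c)
    (hb : |b| ≤ c) (hu : 2 * |u| ≤ c) (hv : 2 * |v| ≤ c) (hp : 0 < p) (hM : 1 ≤ M) (hK : 1 ≤ K) :
    9 * (d : ℝ) ^ 2 * L ^ 2 * (b - a) ^ 2 / A ^ ((2 : ℝ) / d)
        + 4 * (v - u) * depth * ((w : ℝ) + 1) ^ depth * c ^ (depth + 1) * max 1 p / K ^ s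
        + 18 * max 1 ((v - u) ^ 2) * depth * ((w : ℝ) + 1) ^ 2
            * max p (Real.log (3 * M * B * c)) / √M
      ≤ 36 * (d : ℝ) ^ 2 * c ^ 4 / A ^ ((2 : ℝ) / d)
        + 4 * depth * ((w : ℝ) + 1) ^ depth * c ^ (depth + 2) * max 1 p / K ^ s
        + 23 * B ^ 3 * depth * ((w : ℝ) + 1) ^ 2
            * max p (Real.log (Real.exp 1 * M)) / √M := by
  have hba : b - a ≤ 2 * c := by linarith [le_abs_self b, neg_le_of_abs_le ha]
  have hvu : v - u ≤ c := by linarith [le_abs_self v, neg_abs_le u]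
  have hba0 : 0 < b - a := sub_pos.2 hab
  have hvu0 : 0 < v - u := sub_pos.2 huv
  have hA' : 0 < A ^ ((2 : ℝ) / d) := Real.rpow_pos_of_pos hA _
  have hK' : 0 < K ^ s := Real.rpow_pos_of_pos (by linarith) _
  have hm : 0 < max 1 p := lt_max_of_lt_left one_pos
  have hc0 : 0 ≤ c := by linarith
  have hB0 : 0 ≤ B := by linarith
  refine add_le_add (add_le_add ?_ ?_) ?_
  · refine div_le_div_of_nonneg_right ?_ hA'.le
    calc 9 * (d : ℝ) ^ 2 * L ^ 2 * (b - a) ^ 2 ≤ 9 * (d : ℝ) ^ 2 * c ^ 2 * (2 * c) ^ 2 := by gcongr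
      _ = _ := by ring
  · refine div_le_div_of_nonneg_right ?_ hK'.le
    refine mul_le_mul_of_nonneg_right ?_ hm.le
    calc 4 * (v - u) * depth * ((w : ℝ) + 1) ^ depth * c ^ (depth + 1)
        ≤ 4 * c * depth * ((w : ℝ) + 1) ^ depth * c ^ (depth + 1) := by gcongr
      _ = _ := by ring
  · refine div_le_div_of_nonneg_right ?_ (Real.sqrt_nonneg M)
    have h1 : max 1 ((v - u) ^ 2) ≤ B ^ 2 :=
      max_le (one_le_pow₀ (hc.trans hcB)) (by gcongr; linarith)
    have h2 := log_bound_le (p := p) hM hc hcB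
    have h3 : 0 ≤ max p (Real.log (3 * M * B * c)) := le_max_of_le_left hp.le
    calc 18 * max 1 ((v - u) ^ 2) * depth * ((w : ℝ) + 1) ^ 2 * max p (Real.log (3 * M * B * c))
        ≤ 18 * B ^ 2 * depth * ((w : ℝ) + 1) ^ 2 * max p (Real.log (3 * M * B * c)) := by gcongr
      _ = B ^ 2 * depth * ((w : ℝ) + 1) ^ 2 * (18 * max p (Real.log (3 * M * B * c))) := by ring
      _ ≤ B ^ 2 * depth * ((w : ℝ) + 1) ^ 2 * (23 * B * max p (Real.log (Real.exp 1 * M))) := by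
          gcongr
      _ = _ := by ring

end Total

/-! ### Combining the three error contributions. -/

section Selection

variable {Ω : Type*} [MeasurableSpace Ω] {P : Measure Ω} [IsProbabilityMeasure P]
  {D d depth : ℕ} {l : ℕ → ℕ} {a b u v : ℝ}

/-- Deterministic decomposition of the overall error into approximation, generalisation and
optimisation error. -/
lemma sqError_le_of_empRisk_le {ι : Type*} [Fintype ι] [Nonempty ι]
    (h0 : l 0 = d) (h1 : l depth = 1) (hdepth : 1 ≤ depth) (huv : u ≤ v)
    {X : ι → Ω → cube d a b} {Y : ι → Ω → Set.Icc u v}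
    {X₀ : Ω → cube d a b} {Y₀ : Ω → Set.Icc u v} (hX₀ : Measurable X₀) (hY₀ : Measurable Y₀)
    {E : cube d a b → Set.Icc u v} (hEm : Measurable E)
    (hE : (fun ω => (E (X₀ ω) : ℝ)) =ᵐ[P]
      P[fun ω => (Y₀ ω : ℝ) | MeasurableSpace.comap X₀ inferInstance])
    {c g : ℝ} (hc : 1 ≤ c) (ha : |a| ≤ c) (hb : |b| ≤ c) {ω : Ω} {θ θ' ϑ : Fin D → ℝ}
    (hθ : |empRisk h0 h1 X Y θ ω - risk h0 h1 P X₀ Y₀ θ| ≤ g)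
    (hϑ : |empRisk h0 h1 X Y ϑ ω - risk h0 h1 P X₀ Y₀ ϑ| ≤ g)
    (hmin : empRisk h0 h1 X Y θ ω ≤ empRisk h0 h1 X Y θ' ω)
    (hθ'c : ∀ i, |θ' i| ≤ c) (hϑc : ∀ i, |ϑ i| ≤ c) :
    sqError h0 h1 E (P.map X₀) θ ≤ sqError h0 h1 E (P.map X₀) ϑ + 2 * g
      + 2 * (v - u) * (depth * ((maxWidth depth l : ℝ) + 1) ^ depth * c ^ depth)
        * headDist (numParams l depth) ϑ θ' := by
  have hc0 : 0 ≤ c := by linarith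
  -- Only `θ'` and `ϑ` are compared through the Lipschitz bound, so the constant involves `c` and
  -- not the bound `B` on the selected parameter.
  have hnear : ∀ y : cube d a b, |realNN h0 h1 u v θ' y - realNN h0 h1 u v ϑ y|
      ≤ depth * c * ((maxWidth depth l : ℝ) + 1) ^ depth * c ^ (depth - 1)
        * headDist (numParams l depth) ϑ θ' := fun y =>
    realNN_sub_abs_le h0 h1 hc hc (fun i _ => abs_param_le hc0 hθ'c i)
      (fun i _ => abs_param_le hc0 hϑc i) (fun i hi => abs_param_sub_le_headDist hi)
      (headDist_nonneg _ _ _) (abs_le_of_mem_cube ha hb y)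
  have b1 := abs_empRisk_sub_le (X := X) (Y := Y) h0 h1 hdepth huv hnear ω
  have hpow : c ^ (depth - 1) * c = c ^ depth := by
    rw [← pow_succ, Nat.sub_add_cancel hdepth]
  have e : 2 * (v - u) * (depth * c * ((maxWidth depth l : ℝ) + 1) ^ depth * c ^ (depth - 1)
        * headDist (numParams l depth) ϑ θ')
      = 2 * (v - u) * (depth * ((maxWidth depth l : ℝ) + 1) ^ depth * c ^ depth)
        * headDist (numParams l depth) ϑ θ' := by
    rw [← hpow]; ring
  rw [e] at b1
  rw [risk_eq_sqError_add h0 h1 hdepth huv hX₀ hY₀ hEm hE] at hθ hϑ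
  rw [abs_le] at b1 hθ hϑ
  linarith [b1.2, hθ.1, hϑ.2]

/-- The moments of order `p ≥ 1` of the overall error. -/
theorem eLpNorm_sqError_le {ι κ : Type*} [Fintype ι] [Nonempty ι] [Fintype κ] [Nonempty κ]
    (h0 : l 0 = d) (h1 : l depth = 1) (hdepth : 1 ≤ depth) (huv : u < v)
    (hparams : numParams l depth ≤ D) (hnp : 1 ≤ numParams l depth)
    {X : ι → Ω → cube d a b} {Y : ι → Ω → Set.Icc u v} (hX : ∀ j, Measurable (X j))
    (hY : ∀ j, Measurable (Y j)) (hindep : iIndepFun (fun j ω => (X j ω, Y j ω)) P)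
    {X₀ : Ω → cube d a b} {Y₀ : Ω → Set.Icc u v} (hX₀ : Measurable X₀) (hY₀ : Measurable Y₀)
    (hident : ∀ j, IdentDistrib (fun ω => (X j ω, Y j ω)) (fun ω => (X₀ ω, Y₀ ω)) P P)
    {E : cube d a b → Set.Icc u v} (hEm : Measurable E)
    (hE : (fun ω => (E (X₀ ω) : ℝ)) =ᵐ[P]
      P[fun ω => (Y₀ ω : ℝ) | MeasurableSpace.comap X₀ inferInstance])
    {c B p ε : ℝ} (hc : 1 ≤ c) (hcB : c ≤ B) (ha : |a| ≤ c) (hb : |b| ≤ c) (hp : 1 ≤ p)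
    {ϑ : Fin D → ℝ} (hϑ : ∀ i, |ϑ i| ≤ c)
    (happrox : sqError h0 h1 E (P.map X₀) ϑ ≤ ε)
    {Θ : κ → Ω → Fin D → ℝ} (hΘ : ∀ k, Measurable (Θ k)) (hΘindep : iIndepFun Θ P)
    (hunif : ∀ k, P.map (Θ k) = (volume : Measure (Fin D → ℝ))[|cube D (-c) c])
    {T : Ω → Fin D → ℝ} (hTB : ∀ ω i, |T ω i| ≤ B)
    (hTmin : ∀ ω k, empRisk h0 h1 X Y (T ω) ω ≤ empRisk h0 h1 X Y (Θ k ω) ω) :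
    eLpNorm (fun ω => sqError h0 h1 E (P.map X₀) (T ω)) (ENNReal.ofReal p) P
      ≤ ENNReal.ofReal (ε
        + 4 * (v - u) * depth * ((maxWidth depth l : ℝ) + 1) ^ depth * c ^ (depth + 1) * p
            / (Fintype.card κ : ℝ) ^ ((depth : ℝ)⁻¹ * (((maxWidth depth l : ℝ) + 1) ^ 2)⁻¹)
        + 18 * max 1 ((v - u) ^ 2) * depth * ((maxWidth depth l : ℝ) + 1) ^ 2
            * max p (Real.log (3 * Fintype.card ι * B * c)) / √(Fintype.card ι : ℝ)) := by
  obtain ⟨G, hGm, hGdev, hGnorm⟩ := exists_uniform_deviation (D := D) h0 h1 hdepth huv hX hY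
    hindep hX₀ hY₀ hident hc hcB ha hb hp
  have hc0 : 0 < c := by linarith
  have hvu : 0 < v - u := sub_pos.2 huv
  have hmc := eLpNorm_min_headDist_le hΘ hΘindep hc0 hunif hnp hparams hϑ hp
  set f : Ω → ℝ := fun ω => Finset.univ.inf' Finset.univ_nonempty fun k =>
    headDist (numParams l depth) ϑ (Θ k ω)
  have hfm : Measurable f := measurable_min_headDist hΘ _ ϑ
  -- The samples lie in the smaller cube only almost surely, by their uniform law.
  have hcube : ∀ᵐ ω ∂P, ∀ k, Θ k ω ∈ cube D (-c) c := by
    refine ae_all_iff.2 fun k => ?_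
    have : ∀ᵐ θ ∂(P.map (Θ k)), θ ∈ cube D (-c) c := by
      rw [hunif k]; exact ae_cond_mem measurableSet_Icc
    exact ae_of_ae_map (hΘ k).aemeasurable this
  have hpoint : ∀ᵐ ω ∂P, sqError h0 h1 E (P.map X₀) (T ω) ≤ ε + 2 * G ω
      + 2 * (v - u) * (depth * ((maxWidth depth l : ℝ) + 1) ^ depth * c ^ depth) * f ω := by
    filter_upwards [hcube] with ω hω
    obtain ⟨k, -, hk⟩ := Finset.exists_mem_eq_inf' (Finset.univ_nonempty (α := κ)) fun k =>
      headDist (numParams l depth) ϑ (Θ k ω)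
    have hfk : f ω = headDist (numParams l depth) ϑ (Θ k ω) := hk
    rw [hfk]
    have := sqError_le_of_empRisk_le h0 h1 hdepth huv.le hX₀ hY₀ hEm hE hc ha hb
      (hGdev (T ω) (hTB ω) ω) (hGdev ϑ (fun i => (hϑ i).trans hcB) ω) (hTmin ω k)
      (fun i => abs_le.2 ⟨(hω k).1 i, (hω k).2 i⟩) hϑ
    linarith
  have hε : 0 ≤ ε := (sqError_nonneg _ _ _ _ _).trans happrox
  have hm0 : 0 ≤ max p (Real.log (3 * Fintype.card ι * B * c)) := le_max_of_le_left (by linarith)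
  refine (eLpNorm_le_of_ae_le_affine (fun ω => sqError_nonneg _ _ _ _ _) hGm
    hfm.aestronglyMeasurable hε (by positivity) (by positivity) (by positivity) hp hpoint
    hGnorm hmc).trans (ENNReal.ofReal_le_ofReal ?_)
  have hK1 : (1 : ℝ) ≤ Fintype.card κ := by exact_mod_cast Fintype.card_pos
  obtain ⟨w, hw⟩ : ∃ w, w = maxWidth depth l := ⟨_, rfl⟩
  have hdepth' : (0 : ℝ) < depth := by exact_mod_cast hdepth
  -- The network has at most `depth * (w + 1)²` parameters; as `K ≥ 1`, lowering the exponent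
  -- weakens the rate.
  have hexp : (depth : ℝ)⁻¹ * (((w : ℝ) + 1) ^ 2)⁻¹ ≤ ((numParams l depth : ℕ) : ℝ)⁻¹ := by
    rw [← mul_inv]
    have h3 : ((numParams l depth : ℕ) : ℝ) ≤ depth * ((w : ℝ) * (w + 1)) := by
      rw [hw]; exact_mod_cast numParams_le l depth
    have h4 : (0 : ℝ) < numParams l depth := by exact_mod_cast hnp
    refine inv_anti₀ h4 (h3.trans (mul_le_mul_of_nonneg_left ?_ hdepth'.le))
    nlinarith [(Nat.cast_nonneg w : (0 : ℝ) ≤ w)]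
  rw [← hw]
  have hKpow := Real.rpow_le_rpow_of_exponent_le hK1 hexp
  have hK0 : (0 : ℝ) < (Fintype.card κ : ℝ) ^ ((depth : ℝ)⁻¹ * (((w : ℝ) + 1) ^ 2)⁻¹) := by
    positivity
  have hmain : 2 * (v - u) * (depth * ((w : ℝ) + 1) ^ depth * c ^ depth)
        * (2 * c * p / (Fintype.card κ : ℝ) ^ ((numParams l depth : ℝ)⁻¹))
      ≤ 4 * (v - u) * depth * ((w : ℝ) + 1) ^ depth * c ^ (depth + 1) * p
          / (Fintype.card κ : ℝ) ^ ((depth : ℝ)⁻¹ * (((w : ℝ) + 1) ^ 2)⁻¹) := by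
    rw [← mul_div_assoc]
    refine le_trans (div_le_div_of_nonneg_left (by positivity) hK0 hKpow) (le_of_eq ?_)
    congr 1; ring
  have e2 : ∀ s t r : ℝ, 2 * (9 * s * depth * ((w : ℝ) + 1) ^ 2 * t / r)
      = 18 * s * depth * ((w : ℝ) + 1) ^ 2 * t / r := fun s t r => by ring
  rw [e2]
  linarith

end Selection

end ClippedDNN

/-! ### The main theorem. -/

theorem theorem5p6
    (d D depth M K N : ℕ) (hd : 1 ≤ d) (hD : 1 ≤ D) (hdepth : 1 ≤ depth)
    (hM : 1 ≤ M) (hK : 1 ≤ K) (hN : 1 ≤ N)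
    (A L a b u v c B : ℝ) (hA : 0 < A) (hab : a < b) (huv : u < v)
    (hc : max 1 (max L (max |a| (max |b| (max (2 * |u|) (2 * |v|))))) ≤ c) (hB : c ≤ B)
    (l : ℕ → ℕ) (hl : ∀ i ≤ depth, 1 ≤ l i)
    (S : Set ℕ) (hS : S ⊆ Set.Iic N) (hS0 : 0 ∈ S)
    (hdepthA : A * (Set.Ioi ((6 : ℝ) ^ d)).indicator 1 A / (2 * d) + 1 ≤ (depth : ℝ))
    (h0 : l 0 = d)
    (hl1 : A * (Set.Ioi ((6 : ℝ) ^ d)).indicator 1 A ≤ (l 1 : ℝ))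
    (h1 : l depth = 1)
    (hparams : ∑ i ∈ Finset.Icc 1 depth, l i * (l (i - 1) + 1) ≤ D)
    (hli : ∀ i : ℕ, 2 ≤ i → i < depth →
      (Set.Ioi ((6 : ℝ) ^ d)).indicator 1 A * max (A / d - 2 * i + 3) 2 ≤ (l i : ℝ))
    {Ω : Type*} [MeasurableSpace Ω] (P : Measure Ω) [IsProbabilityMeasure P]
    (X : ℕ → Ω → cube d a b) (Y : ℕ → Ω → Set.Icc u v)
    (hX : ∀ j ∈ Finset.Icc 1 M, Measurable (X j))
    (hY : ∀ j ∈ Finset.Icc 1 M, Measurable (Y j))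
    (hXYindep : iIndepFun (fun (j : Finset.Icc 1 M) ω => (X j ω, Y j ω)) P)
    (hXYident : ∀ j ∈ Finset.Icc 1 M,
      IdentDistrib (fun ω => (X j ω, Y j ω)) (fun ω => (X 1 ω, Y 1 ω)) P P)
    (E : cube d a b → Set.Icc u v)
    (hE : (fun ω => (E (X 1 ω) : ℝ)) =ᵐ[P]
      P[fun ω => (Y 1 ω : ℝ) | MeasurableSpace.comap (X 1) inferInstance])
    (hLip : ∀ x y : cube d a b,
      |(E x : ℝ) - (E y : ℝ)| ≤ L * ∑ i : Fin d, |(x : Fin d → ℝ) i - (y : Fin d → ℝ) i|)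
    (Θ : ℕ → ℕ → Ω → Fin D → ℝ) (hΘ : ∀ k n, Measurable (Θ k n))
    (κ : Ω → ℕ × ℕ) (hκ : Measurable κ)
    (hΘB : ∀ k, 1 ≤ k → ∀ ω, Θ k 0 ω ∈ cube D (-B) B)
    (hΘindep : iIndepFun (fun (k : Finset.Icc 1 K) => Θ k 0) P)
    (hΘident : ∀ k ∈ Finset.Icc 1 K, IdentDistrib (Θ k 0) (Θ 1 0) P P)
    (hΘunif : pdf.IsUniform (Θ 1 0) (cube D (-c) c) P volume)
    (R : (Fin D → ℝ) → Ω → ℝ)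
    (hR : ∀ θ ω, R θ ω =
      1 / (M : ℝ) * ∑ j ∈ Finset.Icc 1 M, |realNN h0 h1 u v θ (X j ω) - (Y j ω : ℝ)| ^ 2)
    -- `κ ω` minimises the empirical risk over the admissible indices; the norm on `Fin D → ℝ`
    -- is the maximum norm
    (hκmem : ∀ ω, κ ω ∈
      {q : ℕ × ℕ | q.1 ∈ Finset.Icc 1 K ∧ q.2 ∈ S ∧ ‖Θ q.1 q.2 ω‖ ≤ B})
    (hκmin : ∀ ω, IsMinOn (fun q : ℕ × ℕ => R (Θ q.1 q.2 ω) ω)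
      {q : ℕ × ℕ | q.1 ∈ Finset.Icc 1 K ∧ q.2 ∈ S ∧ ‖Θ q.1 q.2 ω‖ ≤ B} (κ ω)) :
    -- the integrals below are well defined
    (∀ θ : Fin D → ℝ,
      Integrable (fun x : cube d a b => |realNN h0 h1 u v θ x - (E x : ℝ)| ^ 2) (P.map (X 1))) ∧
    Measurable (fun ω => sqError h0 h1 E (P.map (X 1)) (Θ (κ ω).1 (κ ω).2 ω)) ∧
    ∀ p : ℝ, 0 < p →
      Integrable (fun ω => sqError h0 h1 E (P.map (X 1)) (Θ (κ ω).1 (κ ω).2 ω) ^ p) P ∧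
      (∫ ω, sqError h0 h1 E (P.map (X 1)) (Θ (κ ω).1 (κ ω).2 ω) ^ p ∂P) ^ (1 / p)
        ≤ 9 * (d : ℝ) ^ 2 * L ^ 2 * (b - a) ^ 2 / A ^ ((2 : ℝ) / d)
          + 4 * (v - u) * depth * ((maxWidth depth l : ℝ) + 1) ^ depth * c ^ (depth + 1) * max 1 p
              / (K : ℝ) ^ ((depth : ℝ)⁻¹ * (((maxWidth depth l : ℝ) + 1) ^ 2)⁻¹)
          + 18 * max 1 ((v - u) ^ 2) * depth * ((maxWidth depth l : ℝ) + 1) ^ 2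
              * max p (Real.log (3 * M * B * c)) / √(M : ℝ) ∧
      9 * (d : ℝ) ^ 2 * L ^ 2 * (b - a) ^ 2 / A ^ ((2 : ℝ) / d)
          + 4 * (v - u) * depth * ((maxWidth depth l : ℝ) + 1) ^ depth * c ^ (depth + 1) * max 1 p
              / (K : ℝ) ^ ((depth : ℝ)⁻¹ * (((maxWidth depth l : ℝ) + 1) ^ 2)⁻¹)
          + 18 * max 1 ((v - u) ^ 2) * depth * ((maxWidth depth l : ℝ) + 1) ^ 2
              * max p (Real.log (3 * M * B * c)) / √(M : ℝ)
        ≤ 36 * (d : ℝ) ^ 2 * c ^ 4 / A ^ ((2 : ℝ) / d)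
          + 4 * depth * ((maxWidth depth l : ℝ) + 1) ^ depth * c ^ (depth + 2) * max 1 p
              / (K : ℝ) ^ ((depth : ℝ)⁻¹ * (((maxWidth depth l : ℝ) + 1) ^ 2)⁻¹)
          + 23 * B ^ 3 * depth * ((maxWidth depth l : ℝ) + 1) ^ 2
              * max p (Real.log (Real.exp 1 * M)) / √(M : ℝ) := by
  have hc1 : 1 ≤ c := (le_max_left _ _).trans hc
  have hc' := (le_max_right _ _).trans hc
  have hcL : L ≤ c := (le_max_left _ _).trans hc'
  have hcab := (le_max_right _ _).trans hc'
  have hca : |a| ≤ c := (le_max_left _ _).trans hcab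
  have hcb_uv := (le_max_right _ _).trans hcab
  have hcb : |b| ≤ c := (le_max_left _ _).trans hcb_uv
  have hcuv := (le_max_right _ _).trans hcb_uv
  have hcu : 2 * |u| ≤ c := (le_max_left _ _).trans hcuv
  have hcv : 2 * |v| ≤ c := (le_max_right _ _).trans hcuv
  have hL : 0 ≤ L := lipschitz_const_nonneg hd hab hLip
  have hEc : Continuous E := continuous_of_lipschitz_l1 hL hLip
  have hM1 : (1 : ℕ) ∈ Finset.Icc 1 M := Finset.mem_Icc.2 ⟨le_rfl, hM⟩
  have hX1 : Measurable (X 1) := hX 1 hM1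
  have hY1 : Measurable (Y 1) := hY 1 hM1
  have : IsProbabilityMeasure (P.map (X 1)) := Measure.isProbabilityMeasure_map hX1.aemeasurable
  have hTm : Measurable fun ω => Θ (κ ω).1 (κ ω).2 ω := by
    -- The random index takes countably many values, so inserting it preserves measurability.
    have : Measurable fun z : (ℕ × ℕ) × Ω => Θ z.1.1 z.1.2 z.2 :=
      measurable_from_prod_countable_right fun q => hΘ q.1 q.2
    exact this.comp (hκ.prodMk measurable_id)
  have hsqm : Measurable fun ω => sqError h0 h1 E (P.map (X 1)) (Θ (κ ω).1 (κ ω).2 ω) :=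
    (measurable_sqError h0 h1 hEc _).comp hTm
  have hsq0 : ∀ ω, 0 ≤ sqError h0 h1 E (P.map (X 1)) (Θ (κ ω).1 (κ ω).2 ω) :=
    fun ω => sqError_nonneg _ _ _ _ _
  refine ⟨integrable_sq_sub h0 h1 hdepth huv.le hEc.measurable _, hsqm, fun p hp => ⟨?_, ?_, ?_⟩⟩
  · refine Integrable.of_mem_Icc 0 (((v - u) ^ 2) ^ p) (hsqm.pow_const p).aemeasurable
      (Filter.Eventually.of_forall fun ω => ⟨Real.rpow_nonneg (hsq0 ω) p, ?_⟩)
    refine Real.rpow_le_rpow (hsq0 ω) ?_ hp.le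
    exact sqError_le h0 h1 hdepth huv.le hEc.measurable _ fun x =>
      (abs_sub_sq_mem (realNN_mem h0 h1 hdepth huv.le _ _) (E x).2).2
  · obtain ⟨ϑ, hϑ, hϑE⟩ := exists_params_approx (D := D) h0 h1 hd hdepth hparams hA hab hc1 hcL
      hca hcb hcu hcv hdepthA hl1 hli hLip
    have happrox : sqError h0 h1 E (P.map (X 1)) ϑ
        ≤ 9 * (d : ℝ) ^ 2 * L ^ 2 * (b - a) ^ 2 / A ^ ((2 : ℝ) / d) := by
      refine sqError_le h0 h1 hdepth huv.le hEc.measurable _ fun x => ?_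
      refine (pow_le_pow_left₀ (abs_nonneg _) (hϑE x) 2).trans_eq ?_
      rw [div_pow, ← Real.rpow_natCast (A ^ ((1 : ℝ) / d)), ← Real.rpow_mul hA.le]
      congr 1
      · ring
      · congr 1; push_cast; ring
    have hnp : 1 ≤ numParams l depth := by
      obtain ⟨k, rfl⟩ : ∃ k, depth = k + 1 := ⟨depth - 1, by omega⟩
      rw [numParams_succ, h1]; omega
    have : Nonempty (Finset.Icc 1 M) := ⟨⟨1, hM1⟩⟩
    have : Nonempty (Finset.Icc 1 K) := ⟨⟨1, Finset.mem_Icc.2 ⟨le_rfl, hK⟩⟩⟩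
    have hcardM : Fintype.card (Finset.Icc 1 M) = M := by simp
    have hcardK : Fintype.card (Finset.Icc 1 K) = K := by simp
    have hemp : ∀ θ ω, empRisk h0 h1 (fun (j : Finset.Icc 1 M) => X j)
        (fun (j : Finset.Icc 1 M) => Y j) θ ω = R θ ω := fun θ ω => by
      rw [hR, empRisk, hcardM,
        Finset.sum_coe_sort (Finset.Icc 1 M) fun j => |realNN h0 h1 u v θ (X j ω) - (Y j ω : ℝ)| ^ 2]
    have hnorm : ∀ {θ : Fin D → ℝ}, ‖θ‖ ≤ B ↔ ∀ i, |θ i| ≤ B := fun {θ} =>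
      pi_norm_le_iff_of_nonneg (by linarith)
    -- Minkowski's inequality needs order at least one; smaller `p` follow by monotonicity of the
    -- norms on a probability space.
    have hmain := eLpNorm_sqError_le (P := P) (p := max 1 p) h0 h1 hdepth huv hparams hnp
      (X := fun (j : Finset.Icc 1 M) => X j) (Y := fun (j : Finset.Icc 1 M) => Y j)
      (fun j => hX j j.2) (fun j => hY j j.2) hXYindep hX1 hY1 (fun j => hXYident j j.2)
      hEc.measurable hE hc1 hB hca hcb (le_max_left _ _) hϑ happrox
      (Θ := fun (k : Finset.Icc 1 K) => Θ k 0) (fun k => hΘ k 0) hΘindep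
      (fun k => (hΘident k k.2).map_eq.trans hΘunif)
      (T := fun ω => Θ (κ ω).1 (κ ω).2 ω) (fun ω => hnorm.1 (hκmem ω).2.2)
      (fun ω k => by
        rw [hemp, hemp]
        -- Initial samples are always admissible competitors, since `0 ∈ S` and they lie in `[-B,
        -- B]^D`.
        refine isMinOn_iff.1 (hκmin ω) (((k : ℕ), 0) : ℕ × ℕ) ⟨k.2, hS0, hnorm.2 fun i => ?_⟩
        have := hΘB k (Finset.mem_Icc.1 k.2).1 ω
        exact abs_le.2 ⟨this.1 i, this.2 i⟩)
    rw [hcardM, hcardK] at hmain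
    have hlog : 1 ≤ Real.log (3 * M * B * c) := by
      have hM' : (1 : ℝ) ≤ M := by exact_mod_cast hM
      have h3 : (3 : ℝ) * 1 * 1 * 1 ≤ 3 * M * B * c := by
        have := hc1.trans hB
        gcongr
      rw [Real.le_log_iff_exp_le (by linarith)]
      linarith [Real.exp_one_lt_d9]
    -- The `1` is dominated by the logarithm, so it does not appear in the generalisation term.
    have hmax : max (max 1 p) (Real.log (3 * M * B * c)) = max p (Real.log (3 * M * B * c)) := by
      rw [max_comm 1 p, max_assoc, max_eq_right hlog]
    rw [hmax] at hmain
    refine integral_rpow_le_of_eLpNorm_le hsq0 hsqm hp ?_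
      ((eLpNorm_le_eLpNorm_of_exponent_le (ENNReal.ofReal_le_ofReal (le_max_right 1 p))
        hsqm.aestronglyMeasurable).trans hmain)
    have hvu : 0 < v - u := sub_pos.2 huv
    have hm1 : 0 ≤ max p (Real.log (3 * M * B * c)) := le_max_of_le_left hp.le
    positivity
  · exact total_bound_le hA hL hcL hab huv hc1 hB hca hcb hcu hcv hp (by exact_mod_cast hM)
      (by exact_mod_cast hK)
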